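/- Let $n,m\ge 0$, $\mathcal Z=\mathbb R^n$, $\mathcal X=\mathbb R^m$ with their Euclidean norms, $J^f_z$ the Jacobian of $f$ at $z$ and $e_i$ the standard basis vectors. For $f:\mathcal Z\to\mathcal X$ let $\mathrm{Reg}(f)$ be the set of $z$ such that $f$ is $C^2$ near $z$ and $J^f_z$ has full column rank. Call $f$ a *generator* if it is a topological embedding and almost every $z$ lies in $\mathrm{Reg}(f)$. Say that $f$ satisfies **C1** at $z$ if $f$ is differentiable at $z$ and $J^f_z$ has a singular value decomposition with $V=I$, i.e. $J^f_z e_i=s_i u_i$ with $u_1,\dots,u_n$ orthonormal and $s_i\ge 0$ (singular values labelled by the latent axes); and **C2** at $z$ if $\partial s_i^f/\partial z_j=0$ at $z$ for all $i\ne j$, where $s_i^f(z)=\|J^f_z e_i\|$. Put $u_i^f(z)=J^f_ze_i/s_i^f(z)$ (the $i$-th *seam direction*). A *factorised prior* is $p(z)=\prod_i p_i(z_i)$ with arbitrary one-dimensional probability densities $p_i$. The *manifold density* on $f(\mathcal Z)$ is the push-forward density $p_\mu(f(z))=p(z)/\sqrt{\det((J_z^f)^\top J_z^f)}$; the *$i$-th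 seam* of $f$ through $x$ inside $R\subseteq f(\mathcal Z)$ is the set of points of $R$ reached from $x$ along integral curves in $R$ (forwards or backwards) of the field $x'\mapsto (s_i^fu_i^f)(f^{-1}(x'))$; and the *$i$-th seam density* is $p_i(z_i)/s_i^f(z)$, the push-forward of $p_i$ along the seam with respect to arc length. Let $g,d:\mathcal Z\to\mathcal X$ be generators with factorised priors $p^{(g)},p^{(d)}$, satisfying C1 and C2 almost everywhere. Assume $g(\mathcal Z)=d(\mathcal Z)=:\mathcal M$, that the push-forwards of the two priors to $\mathcal M$ coincide, and that for almost every $z$, $p^{(g)}(z)>0$ and the tangent Hessian of $\log p_\mu^{(g)}$ on $\mathcal M$ at $x=g(z)$ exists and has pairwise distinct eigenvalues. (The tangent Hessian at $x$ is the symmetric operator $H$ on $T=T_x\mathcal M$ for which, for some $a\in T$ and with $P$ the orthogonal projection onto $T$, $\ell(y)=\ell(x)+\langle a,P(y-x)\rangle+\tfrac12\langle HP(y-x),P(y-x)\rangle+o(\|y-x\|^2)$ as $y\to x$ in $\mathcal M$, where $\ell=\log p_\mu^{(g)}$.) Let $\varphi=g^{-1}\circ d:\mathcal Z\to\mathcal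 Z$ and $W=\{z\in\mathrm{Reg}(d):\varphi(z)\in\mathrm{Reg}(g)\}$. Then: 1. $\varphi$ is a homeomorphism of $\mathcal Z$, $g\circ\varphi=d$, and $\varphi$ maps the prior $p^{(d)}$ to the prior $p^{(g)}$. 2. $W$ is open and has probability one under $p^{(d)}$, and $\varphi$ restricts to a $C^2$ diffeomorphism from $W$ onto an open set. 3. For almost every $z\in W$, with $x=d(z)$: $p^{(g)}_\mu(x)=p^{(d)}_\mu(x)=\prod_i p_i^{(d)}(z_i)/s_i^d(z)=\prod_i p_i^{(g)}(\varphi(z)_i)/s_i^g(\varphi(z))$. 4. (Uniqueness up to permutation and sign.) For every connected component $\Omega$ of $W$ there are a permutation $\sigma$, signs $\varepsilon_i\in\{1,-1\}$ and constants $c_i>0$ with $\prod_ic_i=1$ such that for all $i$ and all $z\in\Omega$: $u_i^d(z)=\varepsilon_i u^g_{\sigma(i)}(\varphi(z))$; the $i$-th seam of $d$ and the $\sigma(i)$-th seam of $g$ through $d(z)$ inside $d(W)$ are the same set; and $\varphi$ is axis-aligned, i.e. $D\varphi(z)e_i=\varepsilon_i a\,e_{\sigma(i)}$ for some $a>0$.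 Moreover for almost every $z\in\Omega$ and all $i$, $\ p^{(d)}_i(z_i)/s^d_i(z)=c_i\,p^{(g)}_{\sigma(i)}(\varphi(z)_{\sigma(i)})/s^g_{\sigma(i)}(\varphi(z))$. 5. (Global form.) If $W=\mathcal Z$, there are a permutation $\sigma$, signs $\varepsilon_i$ and $C^2$ bijections $h_i:\mathbb R\to\mathbb R$ with $\varepsilon_ih_i'>0$ everywhere such that $\varphi(z)_{\sigma(i)}=h_i(z_i)$ for all $z,i$; for all $z,i$, $u_i^d(z)=\varepsilon_iu^g_{\sigma(i)}(\varphi(z))$ and the $i$-th seam of $d$ through $d(z)$ in $\mathcal M$ is the $\sigma(i)$-th seam of $g$ through it; $h_i$ maps the law with density $p_i^{(d)}$ to the law with density $p^{(g)}_{\sigma(i)}$; and for almost every $z$ and all $i$ the $i$-th seam density of $d$ at $z$ equals the $\sigma(i)$-th seam density of $g$ at $\varphi(z)$. -/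

import Mathlib

open Set Filter Topology MeasureTheory
open scoped ENNReal

noncomputable section

namespace SeamBSS

/-- The latent space `ℝⁿ` and the data space `ℝᵐ`, both with the Euclidean norm. -/
abbrev E (k : ℕ) : Type := EuclideanSpace ℝ (Fin k)

/-- The `i`-th standard basis vector. -/
def stdVec {n : ℕ} (i : Fin n) : E n := EuclideanSpace.single i (1 : ℝ)

/-- The `i`-th column of the Jacobian of `f` at `z`. -/
def col {n m : ℕ} (f : E n → E m) (i : Fin n) (z : E n) : E m := fderiv ℝ f z (stdVec i)

/-- The regular set of `f`: near `z` the map is `C²`, and its Jacobian at `z` has full column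
rank. -/
def regularSet {n m : ℕ} (f : E n → E m) : Set (E n) :=
  {z | ContDiffAt ℝ 2 f z ∧ Function.Injective (fderiv ℝ f z)}

/-- A generator: continuous, injective, parametrising an embedded manifold, and regular at almost
every latent point (in particular differentiable almost everywhere). -/
structure IsGenerator {n m : ℕ} (f : E n → E m) : Prop where
  isEmbedding : IsEmbedding f
  ae_regular : ∀ᵐ z : E n, z ∈ regularSet f

/-! ### Singular values and the constraints C1, C2 -/

/-- C1 at `z`: the Jacobian `J` has a singular value decomposition `J = U S Vᵀ` with `V = I`,
that is, `J eᵢ = sᵢ uᵢ` for orthonormal `uᵢ` and `sᵢ ≥ 0`. No order of the singular values is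
imposed: they are labelled by the latent axes. -/
def C1At {n m : ℕ} (f : E n → E m) (z : E n) : Prop :=
  DifferentiableAt ℝ f z ∧
    ∃ (u : Fin n → E m) (s : Fin n → ℝ), Orthonormal ℝ u ∧
      ∀ i, 0 ≤ s i ∧ fderiv ℝ f z (stdVec i) = s i • u i

/-- The singular value belonging to the `i`-th latent axis (under C1, `sᵢ = ‖J eᵢ‖`). -/
def singVal {n m : ℕ} (f : E n → E m) (i : Fin n) (z : E n) : ℝ := ‖col f i z‖

/-- The left singular vector belonging to the `i`-th latent axis: the `i`-th seam direction. -/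
def seamDir {n m : ℕ} (f : E n → E m) (i : Fin n) (z : E n) : E m :=
  (singVal f i z)⁻¹ • col f i z

/-- C2 at `z`: `∂sᵢ/∂zⱼ` exists and vanishes for all `i ≠ j`. -/
def C2At {n m : ℕ} (f : E n → E m) (z : E n) : Prop :=
  ∀ i j, i ≠ j → HasLineDerivAt ℝ (singVal f i) 0 z (stdVec j)

/-! ### Factorised priors and push-forwards -/

/-- `p` is a family of one-dimensional probability densities. -/
structure IsFactorPrior {n : ℕ} (p : Fin n → ℝ → ℝ) : Prop where
  measurable : ∀ i, Measurable (p i)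
  nonneg : ∀ i t, 0 ≤ p i t
  lintegral_eq_one : ∀ i, ∫⁻ t, ENNReal.ofReal (p i t) = 1

/-- The factorised prior density `p(z) = ∏ᵢ pᵢ(zᵢ)`. -/
def priorDensity {n : ℕ} (p : Fin n → ℝ → ℝ) (z : E n) : ℝ := ∏ i, p i (z i)

/-- The factorised prior, as a measure on the latent space. -/
def priorMeasure {n : ℕ} (p : Fin n → ℝ → ℝ) : Measure (E n) :=
  volume.withDensity fun z => ENNReal.ofReal (priorDensity p z)

/-- The `i`-th factor of the prior, as a measure on the line. -/
def factorMeasure {n : ℕ} (p : Fin n → ℝ → ℝ) (i : Fin n) : Measure ℝ :=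
  volume.withDensity fun t => ENNReal.ofReal (p i t)

/-- The distribution on the manifold: the push-forward of the prior. -/
def pushforward {n m : ℕ} (f : E n → E m) (p : Fin n → ℝ → ℝ) : Measure (E m) :=
  (priorMeasure p).map f

/-- The push-forward density on the manifold `range f`, with respect to its `n`-dimensional
surface measure: `p_μ(f z) = p(z) / √det(JᵀJ)`. -/
def manifoldDensity {n m : ℕ} (f : E n → E m) (p : Fin n → ℝ → ℝ) (x : E m) : ℝ :=
  priorDensity p (Function.invFun f x) /
    Real.sqrt (Matrix.gram ℝ fun i => col f i (Function.invFun f x)).det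

/-- The density along the `i`-th seam: the one-dimensional push-forward `pᵢ(zᵢ) / sᵢ(z)` of the
`i`-th prior factor, with respect to arc length along the seam. -/
def seamDensity {n m : ℕ} (f : E n → E m) (p : Fin n → ℝ → ℝ) (i : Fin n) (z : E n) : ℝ :=
  p i (z i) / singVal f i z

/-! ### Seams -/

/-- The `i`-th seam through `x` inside `R`: the set swept out by the curves in `R` that start
at `x` and follow the field `sᵢ uᵢ = J vᵢ`, where `vᵢ` is the `i`-th standard basis vector
(forwards for `T ≥ 0`, backwards for `T ≤ 0`). -/
def seam {n m : ℕ} (f : E n → E m) (R : Set (E m)) (i : Fin n) (x : E m) : Set (E m) :=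
  {y | ∃ (γ : ℝ → E m) (T : ℝ), γ 0 = x ∧ γ T = y ∧ ∀ t ∈ uIcc 0 T, γ t ∈ R ∧
    HasDerivWithinAt γ
      (singVal f i (Function.invFun f (γ t)) • seamDir f i (Function.invFun f (γ t)))
      (uIcc 0 T) t}

/-! ### The tangent Hessian -/

/-- `H` is the Hessian at `x` of the function `ℓ` on `M`, where `T` is the tangent space of `M`
at `x`: with `P` the orthogonal projection onto `T`,
`ℓ(y) = ℓ(x) + ⟪a, P(y - x)⟫ + ½ ⟪H P(y - x), P(y - x)⟫ + o(‖y - x‖²)` as `y → x` in `M`.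
For a `C²` function on a `C²` submanifold this is the Riemannian Hessian. -/
def IsTangentHessian {m : ℕ} (M : Set (E m)) (ℓ : E m → ℝ) (x : E m)
    (T : Submodule ℝ (E m)) (H : T →ₗ[ℝ] T) : Prop :=
  H.IsSymmetric ∧ ∃ a : T,
    (fun y => ℓ y - ℓ x - inner ℝ a (T.orthogonalProjectionOnto (y - x))
      - (1 / 2 : ℝ) * inner ℝ (H (T.orthogonalProjectionOnto (y - x)))
          (T.orthogonalProjectionOnto (y - x)))
      =o[𝓝[M] x] fun y => ‖y - x‖ ^ 2

/-- The eigenvalues of the symmetric operator `H` on the `n`-dimensional space `T` are pairwise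
distinct. -/
def HasSimpleSpectrum {m : ℕ} (n : ℕ) {T : Submodule ℝ (E m)} (H : T →ₗ[ℝ] T) : Prop :=
  ∃ (b : OrthonormalBasis (Fin n) ℝ T) (ev : Fin n → ℝ), Function.Injective ev ∧
    ∀ i, H (b i) = ev i • b i

/-- At `x = f z` the log-density of the manifold has a tangent Hessian, and its eigenvalues are
pairwise distinct. -/
def HasSimpleTangentHessian {n m : ℕ} (f : E n → E m) (p : Fin n → ℝ → ℝ) (z : E n) : Prop :=
  ∃ H : (fderiv ℝ f z).range →ₗ[ℝ] (fderiv ℝ f z).range,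
    IsTangentHessian (range f) (fun x => Real.log (manifoldDensity f p x)) (f z)
      (fderiv ℝ f z).range H ∧ HasSimpleSpectrum n H

/-! ### The comparison map -/

/-- `φ = g⁻¹ ∘ d`. -/
def transition {n m : ℕ} (g d : E n → E m) (z : E n) : E n := Function.invFun g (d z)

/-- The latent points of `d` that are regular for `d` and correspond to regular points of `g`. -/
def commonRegularSet {n m : ℕ} (g d : E n → E m) : Set (E n) :=
  {z | z ∈ regularSet d ∧ transition g d z ∈ regularSet g}

/-- `φ` restricts to a `C²` diffeomorphism from the open set `W` onto an open set. -/
def IsDiffeoOn {n : ℕ} (φ : E n → E n) (W : Set (E n)) : Prop :=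
  IsOpen W ∧ IsOpen (φ '' W) ∧ ContDiffOn ℝ 2 φ W ∧
    ∃ ψ : E n → E n, ContDiffOn ℝ 2 ψ (φ '' W) ∧ LeftInvOn ψ φ W

end SeamBSS

end

/-!
The two generators are compared through `φ = g⁻¹ ∘ d`. Near a common regular point `φ = L ∘ d` with
`L` a `C²` local left inverse of the immersion `g`, so `φ` is a `C²` diffeomorphism on the common
regular set `W` (`isDiffeoOn_transition`), and the equality of the push-forwards becomes a change of variables
between the priors (`ae_priorDensity_eq`).

The constraints C1 and C2 hold almost everywhere, hence by continuity at every regular point. They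
say that the columns of the Jacobian are orthogonal and that the `i`-th singular value varies only
with the `i`-th coordinate. Two facts follow. The manifold density is the product of the seam
densities, each locally a function of one coordinate, so the mixed differences of its logarithm
vanish; and the mixed second derivatives of the generator are normal to the manifold
(`inner_fderiv_col`). In the second-order expansion of the log-density the mixed term is therefore
`⟪H J eᵢ, J eⱼ⟫`, and it is zero: the seam directions are eigenvectors of the tangent Hessian `H`
(`inner_tangentHessian_eq_zero`). The priors are only measurable and the two densities agree only
almost everywhere, so finite differences along a countable set of steps replace derivatives of the
density.

Both generators share the same `H`, which has simple spectrum, so each column of `Dφ` has exactly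
one nonzero entry (`jacobian_mul_eq_zero`). Its position and sign are locally constant, which gives
the permutation and the signs on a connected component (`exists_perm_sign`). Seams are images of
coordinate lines (`mem_seam_iff`) and `φ` maps coordinate segments into coordinate lines, so the
seams agree (`seam_eq_seam`). The ratios of corresponding seam densities are locally functions of
one coordinate each with product `1`; separating variables on boxes shows that they are constant
(`exists_seamDensity_eq_mul`). In the global case these constants are `1` because the factors of
the priors have mass one (`map_factorMeasure_eq`).
-/

namespace SeamBSS

variable {n m : ℕ}

/-! ### Local structure of a regular generator -/

lemma isOpen_regularSet (f : E n → E m) : IsOpen (regularSet f) := by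
  rw [isOpen_iff_eventually]
  intro z hz
  have h1 : ∀ᶠ y in 𝓝 z, ContDiffAt ℝ 2 f y := hz.1.eventually (by simp)
  have h2 : ContinuousAt (fderiv ℝ f) z :=
    (hz.1.fderiv_right (m := 1) (by norm_num)).continuousAt
  have h3 : ∀ᶠ y in 𝓝 z, Function.Injective (fderiv ℝ f y) :=
    h2.eventually (ContinuousLinearMap.isOpen_injective.mem_nhds hz.2)
  filter_upwards [h1, h3] with y hy1 hy2 using ⟨hy1, hy2⟩

lemma differentiableAt_of_mem_regularSet {f : E n → E m} {z : E n} (hz : z ∈ regularSet f) :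
    DifferentiableAt ℝ f z :=
  hz.1.differentiableAt (by norm_num)

/-- A `C²` immersion has, near each point, a left inverse that is `C²` on the ambient space: the
inverse function theorem applied to the composition with a linear left inverse of the
derivative. -/
lemma exists_contDiffAt_leftInverse {f : E n → E m} {w : E n} (hw : w ∈ regularSet f) :
    ∃ L : E m → E n, ContDiffAt ℝ 2 L (f w) ∧ ∀ᶠ y in 𝓝 w, L (f y) = y := by
  obtain ⟨B, hB⟩ := LinearMap.exists_leftInverse_of_injective
    (fderiv ℝ f w : E n →ₗ[ℝ] E m) (LinearMap.ker_eq_bot.2 hw.2)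
  let B' : E m →L[ℝ] E n := LinearMap.toContinuousLinearMap B
  have hF : ContDiffAt ℝ 2 (fun y => B' (f y)) w := B'.contDiff.contDiffAt.comp w hw.1
  have hF' : HasFDerivAt (fun y => B' (f y))
      ((ContinuousLinearEquiv.refl ℝ (E n) : E n ≃L[ℝ] E n) : E n →L[ℝ] E n) w := by
    have h := B'.hasFDerivAt.comp w (differentiableAt_of_mem_regularSet hw).hasFDerivAt
    exact h.congr_fderiv (ContinuousLinearMap.ext fun v => LinearMap.congr_fun hB v)
  refine ⟨fun x => hF.localInverse hF' (by norm_num) (B' x), ?_, ?_⟩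
  · exact (hF.to_localInverse hF' (by norm_num)).comp (f w) B'.contDiff.contDiffAt
  · exact (hF.hasStrictFDerivAt' hF' (by norm_num)).eventually_left_inverse

lemma contDiffAt_col {f : E n → E m} {z : E n} (hz : z ∈ regularSet f) (i : Fin n) :
    ContDiffAt ℝ 1 (col f i) z :=
  (hz.1.fderiv_right (m := 1) (by norm_num)).clm_apply contDiffAt_const

lemma differentiableAt_col {f : E n → E m} {z : E n} (hz : z ∈ regularSet f) (i : Fin n) :
    DifferentiableAt ℝ (col f i) z :=
  (contDiffAt_col hz i).differentiableAt (by norm_num)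

lemma stdVec_apply (i j : Fin n) : stdVec i j = if j = i then (1 : ℝ) else 0 := by
  simp [stdVec]

lemma stdVec_ne_zero (i : Fin n) : (stdVec i : E n) ≠ 0 := by
  intro h
  have := congrArg (fun v : E n => v i) h
  simp [stdVec_apply] at this

lemma eq_sum_smul_stdVec (v : E n) : v = ∑ i, v i • stdVec i := by
  ext j
  simp [stdVec_apply]

lemma map_eq_sum_smul {F : Type*} [AddCommGroup F] [Module ℝ F] [TopologicalSpace F]
    (A : E n →L[ℝ] F) (v : E n) : A v = ∑ i, v i • A (stdVec i) := by
  conv_lhs => rw [eq_sum_smul_stdVec v]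
  simp

lemma col_ne_zero {f : E n → E m} {z : E n} (hz : z ∈ regularSet f) (i : Fin n) :
    col f i z ≠ 0 := fun h =>
  stdVec_ne_zero i (hz.2 (by rw [map_zero]; exact h))

lemma singVal_pos {f : E n → E m} {z : E n} (hz : z ∈ regularSet f) (i : Fin n) :
    0 < singVal f i z :=
  norm_pos_iff.2 (col_ne_zero hz i)

lemma eq_zero_of_ae_eq_zero {U : Set (E n)} (hU : IsOpen U) {F : E n → ℝ}
    (hF : ContinuousOn F U) (h : ∀ᵐ z : E n, z ∈ U → F z = 0) {z : E n} (hz : z ∈ U) :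
    F z = 0 :=
  Measure.eqOn_open_of_ae_eq (μ := (volume : Measure (E n))) (g := fun _ => (0 : ℝ))
    ((ae_restrict_iff' hU.measurableSet).2 h) hU hF continuousOn_const hz

/-- C1 extends by continuity from almost every point to every regular point: the columns of the
Jacobian are orthogonal there. -/
lemma inner_col_eq_zero {f : E n → E m} (hC : ∀ᵐ z : E n, C1At f z ∧ C2At f z)
    {z : E n} (hz : z ∈ regularSet f) {i j : Fin n} (hij : i ≠ j) :
    inner ℝ (col f i z) (col f j z) = 0 := by
  refine eq_zero_of_ae_eq_zero (isOpen_regularSet f)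
    (F := fun z => inner ℝ (col f i z) (col f j z)) (fun y hy => ?_) ?_ hz
  · exact ((contDiffAt_col hy i).continuousAt.inner
      (contDiffAt_col hy j).continuousAt).continuousWithinAt
  · filter_upwards [hC] with y hy _
    obtain ⟨⟨-, u, s, hu, hs⟩, -⟩ := hy
    simp only [col]
    rw [(hs i).2, (hs j).2, inner_smul_left, inner_smul_right, hu.2 hij]
    simp

lemma fderiv_col_apply {f : E n → E m} {z : E n} (hz : z ∈ regularSet f) (i : Fin n) (v : E n) :
    fderiv ℝ (col f i) z v = fderiv ℝ (fderiv ℝ f) z v (stdVec i) := by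
  have h : DifferentiableAt ℝ (fderiv ℝ f) z :=
    (hz.1.fderiv_right (m := 1) (by norm_num)).differentiableAt (by norm_num)
  have h2 := h.hasFDerivAt.clm_apply (hasFDerivAt_const (stdVec i) z)
  have h3 : HasFDerivAt (col f i) _ z := h2
  rw [h3.fderiv]
  simp

lemma fderiv_col_comm {f : E n → E m} {z : E n} (hz : z ∈ regularSet f) (i j : Fin n) :
    fderiv ℝ (col f i) z (stdVec j) = fderiv ℝ (col f j) z (stdVec i) := by
  rw [fderiv_col_apply hz, fderiv_col_apply hz]
  exact (hz.1.isSymmSndFDerivAt (by simp)) _ _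

lemma continuousOn_fderiv_col {f : E n → E m} (i : Fin n) :
    ContinuousOn (fderiv ℝ (col f i)) (regularSet f) := fun z hz =>
  ((contDiffAt_col hz i).fderiv_right (m := 0) (by norm_num)).continuousAt.continuousWithinAt

/-- C2 extends by continuity from almost every point to every regular point. -/
lemma inner_fderiv_col_self {f : E n → E m} (hC : ∀ᵐ z : E n, C1At f z ∧ C2At f z)
    {z : E n} (hz : z ∈ regularSet f) {i j : Fin n} (hij : i ≠ j) :
    inner ℝ (fderiv ℝ (col f i) z (stdVec j)) (col f i z) = 0 := by
  refine eq_zero_of_ae_eq_zero (isOpen_regularSet f)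
    (F := fun z => inner ℝ (fderiv ℝ (col f i) z (stdVec j)) (col f i z)) ?_ ?_ hz
  · exact ((continuousOn_fderiv_col i).clm_apply continuousOn_const).inner
      fun y hy => (contDiffAt_col hy i).continuousAt.continuousWithinAt
  · filter_upwards [hC] with y hy hyr
    -- both sides are half the derivative of `sᵢ²` in the direction `j`
    have h1 : HasDerivAt (fun t : ℝ => singVal f i (y + t • stdVec j) ^ 2) 0 0 := by
      simpa using HasDerivAt.fun_pow (hy.2 i j hij) 2
    have h2 : HasDerivAt (fun t : ℝ => col f i (y + t • stdVec j))
        (fderiv ℝ (col f i) y (stdVec j)) 0 :=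
      ((differentiableAt_col hyr i).hasFDerivAt.hasLineDerivAt (stdVec j))
    have h3 := h2.inner ℝ h2
    have h4 : (fun t : ℝ => singVal f i (y + t • stdVec j) ^ 2) =
        fun t : ℝ => inner ℝ (col f i (y + t • stdVec j)) (col f i (y + t • stdVec j)) := by
      ext t
      rw [real_inner_self_eq_norm_sq, singVal]
    rw [h4] at h1
    have h5 := h1.unique h3
    simp only [zero_smul, add_zero] at h5
    rw [real_inner_comm (fderiv ℝ (col f i) y (stdVec j))] at h5
    linarith

/-- The mixed second derivatives of `f` are normal to the manifold. For three distinct indices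
this is the usual permutation argument: `⟪∂ⱼ∂ᵢ f, ∂ₖ f⟫` is symmetric in `i, j` and, by
orthogonality of the columns, antisymmetric in `i, k`. -/
lemma inner_fderiv_col {f : E n → E m} (hC : ∀ᵐ z : E n, C1At f z ∧ C2At f z)
    {z : E n} (hz : z ∈ regularSet f) {i j : Fin n} (hij : i ≠ j) (k : Fin n) :
    inner ℝ (fderiv ℝ (col f i) z (stdVec j)) (col f k z) = 0 := by
  by_cases hki : k = i
  · subst hki; exact inner_fderiv_col_self hC hz hij
  by_cases hkj : k = j
  · subst hkj; rw [fderiv_col_comm hz]; exact inner_fderiv_col_self hC hz hij.symm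
  have key : ∀ a b c : Fin n, a ≠ c →
      inner ℝ (fderiv ℝ (col f a) z (stdVec b)) (col f c z) =
        - inner ℝ (fderiv ℝ (col f c) z (stdVec b)) (col f a z) := by
    intro a b c hac
    have h1 := (differentiableAt_col hz a).hasFDerivAt.inner ℝ
      (differentiableAt_col hz c).hasFDerivAt
    have h2 : (fun y => inner ℝ (col f a y) (col f c y)) =ᶠ[𝓝 z] fun _ => (0 : ℝ) := by
      filter_upwards [(isOpen_regularSet f).mem_nhds hz] with y hy
      exact inner_col_eq_zero hC hy hac
    have h3 := h1.unique ((hasFDerivAt_const (0 : ℝ) z).congr_of_eventuallyEq h2)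
    have h4 := congrArg (fun A => A (stdVec b)) h3
    simp [fderivInnerCLM_apply] at h4
    rw [real_inner_comm (fderiv ℝ (col f c) z (stdVec b))] at h4
    linarith
  have e1 := key i j k (Ne.symm hki)
  have e2 := key j k i hij.symm
  have e3 := key k i j hkj
  rw [fderiv_col_comm hz k j] at e1
  rw [fderiv_col_comm hz i k] at e2
  rw [fderiv_col_comm hz j i] at e3
  linarith

lemma gram_col_eq_diagonal {f : E n → E m} (hC : ∀ᵐ z : E n, C1At f z ∧ C2At f z)
    {z : E n} (hz : z ∈ regularSet f) :
    Matrix.gram ℝ (fun i => col f i z) = Matrix.diagonal fun i => singVal f i z ^ 2 := by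
  ext i j
  by_cases hij : i = j
  · subst hij; simp [Matrix.gram, singVal]
  · simp [Matrix.gram, Matrix.diagonal_apply_ne _ hij, inner_col_eq_zero hC hz hij]

/-- The seam densities factorise the manifold density. -/
lemma manifoldDensity_eq_prod_seamDensity {f : E n → E m} (hf : Function.Injective f)
    (hC : ∀ᵐ z : E n, C1At f z ∧ C2At f z) (p : Fin n → ℝ → ℝ)
    {z : E n} (hz : z ∈ regularSet f) :
    manifoldDensity f p (f z) = ∏ i, seamDensity f p i z := by
  have h1 : Function.invFun f (f z) = z := Function.leftInverse_invFun hf z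
  simp only [manifoldDensity, seamDensity, h1, priorDensity, Finset.prod_div_distrib]
  rw [gram_col_eq_diagonal hC hz, Matrix.det_diagonal, Finset.prod_pow, Real.sqrt_sq]
  exact Finset.prod_nonneg fun i _ => norm_nonneg _

/-- A function with vanishing derivative in all directions orthogonal to the `i`-th axis depends,
on a convex set, only on the `i`-th coordinate. -/
lemma eq_of_apply_eq_of_fderiv_eq_zero {U : Set (E n)} (hU : Convex ℝ U) {F : E n → ℝ}
    {F' : E n → E n →L[ℝ] ℝ} (hF : ∀ y ∈ U, HasFDerivAt F (F' y) y) {i : Fin n}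
    (h0 : ∀ y ∈ U, ∀ j, j ≠ i → F' y (stdVec j) = 0)
    {y y' : E n} (hy : y ∈ U) (hy' : y' ∈ U) (hi : y i = y' i) : F y = F y' := by
  have hmem : ∀ t ∈ Icc (0 : ℝ) 1, y + t • (y' - y) ∈ U := fun t ht =>
    hU.add_smul_sub_mem hy hy' ht
  have hder : ∀ t ∈ Icc (0 : ℝ) 1,
      HasDerivWithinAt (fun t : ℝ => F (y + t • (y' - y))) 0 (Icc 0 1) t := by
    intro t ht
    have h1 : HasDerivAt (fun t : ℝ => y + t • (y' - y)) (y' - y) t := by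
      simpa using ((hasDerivAt_id t).smul_const (y' - y)).const_add y
    have h2 := (hF _ (hmem t ht)).comp_hasDerivAt t h1
    have h3 : F' (y + t • (y' - y)) (y' - y) = 0 := by
      rw [map_eq_sum_smul]
      refine Finset.sum_eq_zero fun j _ => ?_
      by_cases hj : j = i
      · subst hj; simp [hi]
      · rw [h0 _ (hmem t ht) j hj, smul_zero]
    rw [h3] at h2
    exact h2.hasDerivWithinAt
  have h := (convex_Icc (0 : ℝ) 1).norm_image_sub_le_of_norm_hasDerivWithin_le (C := 0) hder
    (by simp) (left_mem_Icc.2 zero_le_one) (right_mem_Icc.2 zero_le_one)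
  simp only [one_smul, zero_smul, add_zero, add_sub_cancel, zero_mul, norm_le_zero_iff] at h
  linarith

lemma hasFDerivAt_singVal_sq {f : E n → E m} {z : E n} (hz : z ∈ regularSet f) (i : Fin n) :
    HasFDerivAt (fun y => singVal f i y ^ 2)
      (2 • (innerSL ℝ (col f i z)).comp (fderiv ℝ (col f i) z)) z :=
  (differentiableAt_col hz i).hasFDerivAt.norm_sq

lemma fderiv_singVal_sq_eq_zero {f : E n → E m} (hC : ∀ᵐ z : E n, C1At f z ∧ C2At f z)
    {z : E n} (hz : z ∈ regularSet f) {i j : Fin n} (hij : j ≠ i) :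
    (2 • (innerSL ℝ (col f i z)).comp (fderiv ℝ (col f i) z)) (stdVec j) = 0 := by
  have h := inner_fderiv_col_self hC hz hij.symm
  rw [real_inner_comm] at h
  simp [h]

/-- On a convex set of regular points the `i`-th seam density depends only on the `i`-th
latent coordinate. -/
lemma seamDensity_eq_of_apply_eq {f : E n → E m} (hC : ∀ᵐ z : E n, C1At f z ∧ C2At f z)
    (p : Fin n → ℝ → ℝ) {U : Set (E n)} (hU : Convex ℝ U) (hUr : U ⊆ regularSet f) {i : Fin n}
    {y y' : E n} (hy : y ∈ U) (hy' : y' ∈ U) (hi : y i = y' i) :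
    seamDensity f p i y = seamDensity f p i y' := by
  have h := eq_of_apply_eq_of_fderiv_eq_zero hU
    (fun w hw => hasFDerivAt_singVal_sq (hUr hw) i)
    (fun w hw j hj => fderiv_singVal_sq_eq_zero hC (hUr hw) hj) hy hy' hi
  have h2 : singVal f i y = singVal f i y' :=
    (sq_eq_sq₀ (singVal_pos (hUr hy) i).le (singVal_pos (hUr hy') i).le).1 h
  rw [seamDensity, seamDensity, h2, hi]

/-! ### The tangent Hessian is diagonal in the seam directions -/

/-- The second difference of `A ∘ f` is `o(t²)` where the mixed second derivative vanishes. Only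
strict differentiability of one column of the Jacobian is used, so `C²` at the point suffices. -/
lemma mixedDifference_isLittleO {f : E n → E m} {z : E n} (hz : z ∈ regularSet f)
    (A : E m →L[ℝ] ℝ) {i j : Fin n} (hA : A (fderiv ℝ (col f i) z (stdVec j)) = 0) :
    (fun t : ℝ => A (f (z + t • stdVec i + t • stdVec j) - f (z + t • stdVec i)
      - f (z + t • stdVec j) + f z)) =o[𝓝 0] fun t : ℝ => t ^ 2 := by
  rw [Asymptotics.isLittleO_iff]
  intro c hc
  set c' : ℝ := c / (‖A‖ + 1) with hc'
  have hA1 : 0 < ‖A‖ + 1 := by positivity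
  have hc'0 : 0 < c' := by positivity
  have hs := (contDiffAt_col hz i).hasStrictFDerivAt (by norm_num)
  have h1 := (Asymptotics.isLittleO_iff.1 hs.isLittleO) hc'0
  have h2 : ∀ᶠ q in 𝓝 ((z, z) : E n × E n), q.1 ∈ regularSet f ∧ q.2 ∈ regularSet f :=
    (((isOpen_regularSet f).preimage continuous_fst).inter
      ((isOpen_regularSet f).preimage continuous_snd)).mem_nhds ⟨hz, hz⟩
  have hcont : Continuous fun r : ℝ × ℝ =>
      ((z + r.1 • stdVec i + r.2 • stdVec j, z + r.1 • stdVec i) : E n × E n) := by fun_prop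
  have hlim : Tendsto (fun r : ℝ × ℝ =>
      ((z + r.1 • stdVec i + r.2 • stdVec j, z + r.1 • stdVec i) : E n × E n))
      (𝓝 (0, 0)) (𝓝 (z, z)) := by simpa using hcont.tendsto (0, 0)
  have h3 := hlim.eventually (h1.and h2)
  obtain ⟨δ, hδ, h4⟩ := Metric.eventually_nhds_iff.1 h3
  filter_upwards [Metric.ball_mem_nhds (0 : ℝ) hδ] with t ht
  have ht' : |t| < δ := by simpa using ht
  have hst : ∀ s ∈ Icc (-|t|) |t|, dist ((s, t) : ℝ × ℝ) (0, 0) < δ := by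
    intro s hs
    have : |s| ≤ |t| := abs_le.2 hs
    rw [Prod.dist_eq]
    simpa using ⟨this.trans_lt ht', ht'⟩
  have hder : ∀ s ∈ Icc (-|t|) |t|, HasDerivWithinAt
      (fun s : ℝ => A (f (z + s • stdVec i + t • stdVec j) - f (z + s • stdVec i)))
      (A (col f i (z + s • stdVec i + t • stdVec j) - col f i (z + s • stdVec i)))
      (Icc (-|t|) |t|) s := by
    intro s hs
    obtain ⟨-, hr1, hr2⟩ := h4 (hst s hs)
    have e1 : HasDerivAt (fun s : ℝ => z + s • stdVec i + t • stdVec j) (stdVec i) s := by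
      simpa using (((hasDerivAt_id s).smul_const (stdVec i)).const_add z).add_const
        (t • stdVec j)
    have e2 : HasDerivAt (fun s : ℝ => z + s • stdVec i) (stdVec i) s := by
      simpa using ((hasDerivAt_id s).smul_const (stdVec i)).const_add z
    have d1 := (differentiableAt_of_mem_regularSet hr1).hasFDerivAt.comp_hasDerivAt s e1
    have d2 := (differentiableAt_of_mem_regularSet hr2).hasFDerivAt.comp_hasDerivAt s e2
    exact (A.hasFDerivAt.comp_hasDerivAt s (d1.sub d2)).hasDerivWithinAt
  have hbound : ∀ s ∈ Icc (-|t|) |t|,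
      ‖A (col f i (z + s • stdVec i + t • stdVec j) - col f i (z + s • stdVec i))‖ ≤ c * |t| := by
    intro s hs
    obtain ⟨hb, -, -⟩ := h4 (hst s hs)
    simp only [add_sub_cancel_left] at hb
    have e : A (col f i (z + s • stdVec i + t • stdVec j) - col f i (z + s • stdVec i)) =
        A (col f i (z + s • stdVec i + t • stdVec j) - col f i (z + s • stdVec i)
          - fderiv ℝ (col f i) z (t • stdVec j)) := by
      rw [map_sub A _ (fderiv ℝ (col f i) z (t • stdVec j)), map_smul, map_smul, hA]
      simp
    rw [e]
    calc _ ≤ ‖A‖ * (c' * ‖t • (stdVec j : E n)‖) := (A.le_opNorm _).trans (by gcongr)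
      _ ≤ (‖A‖ + 1) * (c' * ‖t • (stdVec j : E n)‖) := by gcongr; linarith
      _ = c * |t| := by
        rw [norm_smul, hc']
        simp [stdVec]
        field_simp
  have h := (convex_Icc (-|t|) |t|).norm_image_sub_le_of_norm_hasDerivWithin_le hder hbound
    (x := 0) (y := t) ⟨by simp, by simp⟩ ⟨neg_abs_le t, le_abs_self t⟩
  simp only [zero_smul, add_zero, sub_zero] at h
  rw [← map_sub] at h
  calc _ = ‖A (f (z + t • stdVec i + t • stdVec j) - f (z + t • stdVec i)
          - (f (z + t • stdVec j) - f z))‖ := by congr 2; abel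
    _ ≤ c * |t| * ‖t‖ := h
    _ = c * ‖t ^ 2‖ := by rw [norm_pow, Real.norm_eq_abs]; ring

/-- A sum of functions each depending, on a convex set, on its own coordinate only has vanishing
mixed differences. -/
lemma mixedDifference_sum_eq_zero {U : Set (E n)} {s : Fin n → E n → ℝ}
    (hs : ∀ k, ∀ y ∈ U, ∀ y' ∈ U, y k = y' k → s k y = s k y') {i j : Fin n} (hij : i ≠ j)
    {z : E n} {t : ℝ} (h0 : z ∈ U) (h1 : z + t • stdVec i ∈ U) (h2 : z + t • stdVec j ∈ U)
    (h3 : z + t • stdVec i + t • stdVec j ∈ U) :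
    ∑ k, s k (z + t • stdVec i + t • stdVec j) - ∑ k, s k (z + t • stdVec i)
      - ∑ k, s k (z + t • stdVec j) + ∑ k, s k z = 0 := by
  rw [← Finset.sum_sub_distrib, ← Finset.sum_sub_distrib, ← Finset.sum_add_distrib]
  refine Finset.sum_eq_zero fun k _ => ?_
  by_cases hk : k = i
  · have hkj : k ≠ j := fun h => hij (hk ▸ h)
    rw [hs k _ h3 _ h1 (by simp [stdVec_apply, hkj]), hs k _ h2 _ h0 (by simp [stdVec_apply, hkj])]
    ring
  · rw [hs k _ h3 _ h2 (by simp [stdVec_apply, hk]), hs k _ h1 _ h0 (by simp [stdVec_apply, hk])]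
    ring

/-- Let `ℓ` be the log-density, factorised by the seam densities, on enough points near `z`. Its
second-order expansion at `f z` is compared with the vanishing mixed differences of a sum of
functions of one coordinate each; since the mixed second derivatives of `f` are normal to the
manifold, only the Hessian term `⟪H J eᵢ, J eⱼ⟫` survives in the limit. -/
lemma inner_tangentHessian_eq_zero {f : E n → E m}
    (hC : ∀ᵐ z : E n, C1At f z ∧ C2At f z) (p : Fin n → ℝ → ℝ) {z : E n}
    (hz : z ∈ regularSet f) {ℓ : E m → ℝ} {T : Submodule ℝ (E m)}
    (hT : T = (fderiv ℝ f z).range) {H : T →ₗ[ℝ] T}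
    (hH : IsTangentHessian (range f) ℓ (f z) T H) {i j : Fin n} (hij : i ≠ j)
    {t : ℕ → ℝ} (ht : Tendsto t atTop (𝓝[≠] 0))
    (hgood : ∀ v ∈ ({0, stdVec i, stdVec j, stdVec i + stdVec j} : Set (E n)),
      ∀ᶠ k in atTop, ℓ (f (z + t k • v)) =
        ∑ l, Real.log (seamDensity f p l (z + t k • v))) :
    inner ℝ (H (T.orthogonalProjectionOnto (col f i z)))
      (T.orthogonalProjectionOnto (col f j z)) = 0 := by
  obtain ⟨hsymm, a, ha⟩ := hH
  have ht0 : Tendsto t atTop (𝓝 0) := ht.mono_right nhdsWithin_le_nhds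
  set P := T.orthogonalProjectionOnto
  set q : E m → ℝ := fun x => (1 / 2 : ℝ) * inner ℝ (H (P x)) (P x) with hq
  have hHc : Continuous H := H.continuous_of_finiteDimensional
  have hqc : Continuous q := by
    have : Continuous fun x => P x := P.continuous
    exact continuous_const.mul ((hHc.comp this).inner this)
  have hq2 : ∀ (c : ℝ) (x : E m), q (c • x) = c ^ 2 * q x := by
    intro c x
    simp only [hq]
    rw [map_smul, map_smul, Submodule.coe_inner, Submodule.coe_inner, Submodule.coe_smul,
      Submodule.coe_smul, real_inner_smul_left, real_inner_smul_right]
    ring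
  -- the remainder of the second-order expansion of `ℓ` along the ray in direction `v`
  set R : E n → ℝ → ℝ := fun v s => ℓ (f (z + s • v)) - ℓ (f z)
    - inner ℝ a (P (f (z + s • v) - f z)) - q (f (z + s • v) - f z) with hR
  have hray : ∀ v : E n, HasDerivAt (fun s : ℝ => f (z + s • v)) (fderiv ℝ f z v) 0 := fun v =>
    (differentiableAt_of_mem_regularSet hz).hasFDerivAt.hasLineDerivAt v
  have hslope : ∀ v : E n, Tendsto (fun k => (t k)⁻¹ • (f (z + t k • v) - f z)) atTop
      (𝓝 (fderiv ℝ f z v)) := by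
    intro v
    have := (hasDerivAt_iff_tendsto_slope.1 (hray v)).comp ht
    refine this.congr fun k => ?_
    simp [slope_def_module]
  have hRlim : ∀ v : E n, Tendsto (fun k => R v (t k) / t k ^ 2) atTop (𝓝 0) := by
    intro v
    have hc : Tendsto (fun s : ℝ => f (z + s • v)) (𝓝 0) (𝓝[range f] (f z)) := by
      refine tendsto_nhdsWithin_iff.2 ⟨?_, Eventually.of_forall fun s => mem_range_self _⟩
      simpa using (hray v).continuousAt.tendsto
    have hO : (fun s : ℝ => ‖f (z + s • v) - f z‖ ^ 2) =O[𝓝 0] fun s : ℝ => s ^ 2 := by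
      have h1 := (hray v).isBigO_sub
      simp only [zero_smul, add_zero, sub_zero] at h1
      exact h1.norm_left.pow 2
    have h2 := ((ha.comp_tendsto hc).trans_isBigO hO).comp_tendsto ht0
    exact h2.tendsto_div_nhds_zero
  have hqlim : ∀ v : E n, Tendsto (fun k => q (f (z + t k • v) - f z) / t k ^ 2) atTop
      (𝓝 (q (fderiv ℝ f z v))) := by
    intro v
    refine ((hqc.tendsto _).comp (hslope v)).congr fun k => ?_
    simp only [Function.comp, hq2]
    rw [inv_pow, div_eq_inv_mul]
  have hainner : ∀ x : E m, inner ℝ a (P x) = inner ℝ (a : E m) x := fun x =>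
    Submodule.inner_orthogonalProjectionOnto_eq_of_mem_left a x
  have hlin : Tendsto (fun k => inner ℝ (a : E m)
      (f (z + t k • stdVec i + t k • stdVec j) - f (z + t k • stdVec i)
      - f (z + t k • stdVec j) + f z) / t k ^ 2) atTop (𝓝 0) := by
    have hA : innerSL ℝ (a : E m) (fderiv ℝ (col f i) z (stdVec j)) = 0 := by
      have hmem : (a : E m) ∈ (fderiv ℝ f z).range := hT ▸ a.2
      obtain ⟨v, hv⟩ := hmem
      have hv' : (a : E m) = ∑ l, v l • col f l z := by
        rw [← hv]; exact map_eq_sum_smul _ v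
      rw [innerSL_apply_apply, hv', sum_inner]
      refine Finset.sum_eq_zero fun l _ => ?_
      rw [inner_smul_left, real_inner_comm, inner_fderiv_col hC hz hij, mul_zero]
    exact ((mixedDifference_isLittleO hz (innerSL ℝ (a : E m)) hA).comp_tendsto
      ht0).tendsto_div_nhds_zero
  -- the mixed difference of `ℓ` vanishes close to `z`
  obtain ⟨r, hr, hball⟩ := Metric.isOpen_iff.1 (isOpen_regularSet f) z hz
  have hin : ∀ v : E n, ∀ᶠ k in atTop, z + t k • v ∈ Metric.ball z r := by
    intro v
    have h1 : Tendsto (fun k => z + t k • v) atTop (𝓝 z) := by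
      simpa using (ht0.smul_const v).const_add z
    exact h1 (Metric.ball_mem_nhds z hr)
  have hzero : ∀ᶠ k in atTop, ℓ (f (z + t k • (stdVec i + stdVec j))) - ℓ (f (z + t k • stdVec i))
      - ℓ (f (z + t k • stdVec j)) + ℓ (f z) = 0 := by
    filter_upwards [hgood 0 (by simp), hgood (stdVec i) (by simp), hgood (stdVec j) (by simp),
      hgood (stdVec i + stdVec j) (by simp), hin (stdVec i), hin (stdVec j),
      hin (stdVec i + stdVec j)] with k g0 g1 g2 g3 m1 m2 m3
    rw [smul_zero, add_zero] at g0
    rw [g0, g1, g2, g3]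
    rw [smul_add, ← add_assoc] at m3 ⊢
    exact mixedDifference_sum_eq_zero (s := fun l y => Real.log (seamDensity f p l y))
      (fun l y hy y' hy' h => congrArg Real.log
        (seamDensity_eq_of_apply_eq hC p (convex_ball z r) hball hy hy' h))
      hij (Metric.mem_ball_self hr) m1 m2 m3
  have hlim : Tendsto (fun k => R (stdVec i + stdVec j) (t k) / t k ^ 2
      - R (stdVec i) (t k) / t k ^ 2 - R (stdVec j) (t k) / t k ^ 2
      + inner ℝ (a : E m) (f (z + t k • stdVec i + t k • stdVec j) - f (z + t k • stdVec i)
        - f (z + t k • stdVec j) + f z) / t k ^ 2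
      + (q (f (z + t k • (stdVec i + stdVec j)) - f z) / t k ^ 2
        - q (f (z + t k • stdVec i) - f z) / t k ^ 2
        - q (f (z + t k • stdVec j) - f z) / t k ^ 2)) atTop
      (𝓝 (0 - 0 - 0 + 0 + (q (fderiv ℝ f z (stdVec i + stdVec j)) - q (fderiv ℝ f z (stdVec i))
        - q (fderiv ℝ f z (stdVec j))))) :=
    ((((hRlim _).sub (hRlim _)).sub (hRlim _)).add hlin).add
      (((hqlim _).sub (hqlim _)).sub (hqlim _))
  have hval := tendsto_nhds_unique (hlim.congr' (f₂ := fun _ => (0 : ℝ)) ?_) tendsto_const_nhds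
  · have hs := hsymm (P (col f j z)) (P (col f i z))
    rw [real_inner_comm (H (P (col f i z)))] at hs
    simp only [map_add] at hval
    change _ + (q (col f i z + col f j z) - q (col f i z) - q (col f j z)) = 0 at hval
    simp only [hq, map_add, inner_add_left, inner_add_right] at hval
    linarith
  · filter_upwards [hzero] with k hk
    rw [← sub_div, ← sub_div, ← add_div, ← sub_div, ← sub_div, ← add_div, div_eq_zero_iff]
    left
    simp only [hR, hainner]
    rw [smul_add, ← add_assoc] at hk ⊢
    simp only [inner_sub_right, inner_add_right]
    linarith

/-! ### The comparison map -/

lemma apply_transition {g d : E n → E m} (hM : range g = range d) (z : E n) :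
    g (transition g d z) = d z :=
  Function.invFun_eq (hM ▸ mem_range_self z : d z ∈ range g)

lemma transition_transition {g d : E n → E m} (hd : Function.Injective d)
    (hM : range g = range d) (z : E n) : transition d g (transition g d z) = z := by
  rw [transition, apply_transition hM]
  exact Function.leftInverse_invFun hd z

lemma continuous_transition {g d : E n → E m} (hg : IsGenerator g) (hd : IsGenerator d)
    (hM : range g = range d) : Continuous (transition g d) := by
  rw [hg.isEmbedding.continuous_iff]
  have : g ∘ transition g d = d := funext (apply_transition hM)
  rw [this]
  exact hd.isEmbedding.continuous

lemma isHomeomorph_transition {g d : E n → E m} (hg : IsGenerator g) (hd : IsGenerator d)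
    (hM : range g = range d) : IsHomeomorph (transition g d) :=
  Homeomorph.isHomeomorph
    { toFun := transition g d
      invFun := transition d g
      left_inv := transition_transition hd.isEmbedding.injective hM
      right_inv := transition_transition hg.isEmbedding.injective hM.symm
      continuous_toFun := continuous_transition hg hd hM
      continuous_invFun := continuous_transition hd hg hM.symm }

lemma map_transition_priorMeasure {g d : E n → E m} {pg pd : Fin n → ℝ → ℝ}
    (hg : IsGenerator g) (hd : IsGenerator d) (hM : range g = range d)
    (hmatch : pushforward g pg = pushforward d pd) :
    (priorMeasure pd).map (transition g d) = priorMeasure pg := by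
  have hme : MeasurableEmbedding g :=
    hg.isEmbedding.continuous.measurableEmbedding hg.isEmbedding.injective
  have h1 : ((priorMeasure pd).map (transition g d)).map g = (priorMeasure pg).map g := by
    rw [Measure.map_map hme.measurable (continuous_transition hg hd hM).measurable]
    have : g ∘ transition g d = d := funext (apply_transition hM)
    rw [this]
    exact hmatch.symm
  rw [← hme.comap_map ((priorMeasure pd).map (transition g d)), h1, hme.comap_map]

lemma isOpen_commonRegularSet {g d : E n → E m} (hg : IsGenerator g) (hd : IsGenerator d)
    (hM : range g = range d) : IsOpen (commonRegularSet g d) :=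
  (isOpen_regularSet d).inter
    ((isOpen_regularSet g).preimage (continuous_transition hg hd hM))

lemma transition_mem_commonRegularSet {g d : E n → E m} (hd : IsGenerator d)
    (hM : range g = range d) {z : E n} (hz : z ∈ commonRegularSet g d) :
    transition g d z ∈ commonRegularSet d g :=
  ⟨hz.2, by rw [transition_transition hd.isEmbedding.injective hM]; exact hz.1⟩

lemma image_commonRegularSet {g d : E n → E m} (hg : IsGenerator g) (hd : IsGenerator d)
    (hM : range g = range d) :
    transition g d '' commonRegularSet g d = commonRegularSet d g := by
  refine Subset.antisymm ?_ fun w hw => ⟨transition d g w, ?_, ?_⟩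
  · rintro _ ⟨z, hz, rfl⟩
    exact transition_mem_commonRegularSet hd hM hz
  · exact transition_mem_commonRegularSet hg hM.symm hw
  · exact transition_transition hg.isEmbedding.injective hM.symm w

/-- Near a common regular point, `φ = L ∘ d` for a `C²` local left inverse `L` of `g`. -/
lemma contDiffAt_transition {g d : E n → E m} (hg : IsGenerator g) (hd : IsGenerator d)
    (hM : range g = range d) {z : E n} (hz : z ∈ commonRegularSet g d) :
    ContDiffAt ℝ 2 (transition g d) z := by
  obtain ⟨L, hL, hLg⟩ := exists_contDiffAt_leftInverse hz.2
  rw [apply_transition hM] at hL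
  refine (hL.comp z hz.1.1).congr_of_eventuallyEq ?_
  filter_upwards [(continuous_transition hg hd hM).continuousAt.eventually hLg] with y hy
  rw [Function.comp_apply, ← apply_transition hM y, hy]

lemma differentiableAt_transition {g d : E n → E m} (hg : IsGenerator g) (hd : IsGenerator d)
    (hM : range g = range d) {z : E n} (hz : z ∈ commonRegularSet g d) :
    DifferentiableAt ℝ (transition g d) z :=
  (contDiffAt_transition hg hd hM hz).differentiableAt (by norm_num)

lemma isDiffeoOn_transition {g d : E n → E m} (hg : IsGenerator g) (hd : IsGenerator d)
    (hM : range g = range d) : IsDiffeoOn (transition g d) (commonRegularSet g d) := by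
  refine ⟨isOpen_commonRegularSet hg hd hM, ?_,
    fun z hz => (contDiffAt_transition hg hd hM hz).contDiffWithinAt, transition d g, ?_,
    fun z _ => transition_transition hd.isEmbedding.injective hM z⟩
  · rw [image_commonRegularSet hg hd hM]
    exact isOpen_commonRegularSet hd hg hM.symm
  · rw [image_commonRegularSet hg hd hM]
    exact fun z hz => (contDiffAt_transition hd hg hM.symm hz).contDiffWithinAt

lemma fderiv_eq_comp_fderiv_transition {g d : E n → E m} (hg : IsGenerator g)
    (hd : IsGenerator d) (hM : range g = range d) {z : E n} (hz : z ∈ commonRegularSet g d) :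
    fderiv ℝ d z = (fderiv ℝ g (transition g d z)).comp (fderiv ℝ (transition g d) z) := by
  have h : d = g ∘ transition g d := funext fun y => (apply_transition hM y).symm
  conv_lhs => rw [h]
  exact fderiv_comp z (differentiableAt_of_mem_regularSet hz.2)
    (differentiableAt_transition hg hd hM hz)

lemma injective_fderiv_transition {g d : E n → E m} (hg : IsGenerator g)
    (hd : IsGenerator d) (hM : range g = range d) {z : E n} (hz : z ∈ commonRegularSet g d) :
    Function.Injective (fderiv ℝ (transition g d) z) := by
  have h := hz.1.2
  rw [fderiv_eq_comp_fderiv_transition hg hd hM hz] at h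
  exact Function.Injective.of_comp (f := fderiv ℝ g (transition g d z)) h

lemma range_fderiv_eq {g d : E n → E m} (hg : IsGenerator g)
    (hd : IsGenerator d) (hM : range g = range d) {z : E n} (hz : z ∈ commonRegularSet g d) :
    (fderiv ℝ g (transition g d z)).range = (fderiv ℝ d z).range := by
  have hsurj : Function.Surjective (fderiv ℝ (transition g d) z : E n →ₗ[ℝ] E n) :=
    LinearMap.injective_iff_surjective.1 (injective_fderiv_transition hg hd hM hz)
  rw [fderiv_eq_comp_fderiv_transition hg hd hM hz]
  ext x
  constructor
  · rintro ⟨v, rfl⟩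
    obtain ⟨w, rfl⟩ := hsurj v
    exact ⟨w, rfl⟩
  · rintro ⟨w, rfl⟩
    exact ⟨fderiv ℝ (transition g d) z w, rfl⟩

/-- The matrix of `Dφ(z)` in the standard basis: the `i`-th column is the image of `eᵢ`. -/
noncomputable def jacobian (φ : E n → E n) (z : E n) : Matrix (Fin n) (Fin n) ℝ :=
  Matrix.of fun k i => fderiv ℝ φ z (stdVec i) k

lemma det_jacobian (φ : E n → E n) (z : E n) : (jacobian φ z).det = (fderiv ℝ φ z).det := by
  rw [ContinuousLinearMap.det, ← LinearMap.det_toMatrix (EuclideanSpace.basisFun (Fin n) ℝ).toBasis]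
  congr 1

lemma det_jacobian_ne_zero {g d : E n → E m} (hg : IsGenerator g) (hd : IsGenerator d)
    (hM : range g = range d) {z : E n} (hz : z ∈ commonRegularSet g d) :
    (jacobian (transition g d) z).det ≠ 0 := by
  rw [det_jacobian]
  intro h
  have h1 := LinearMap.bot_lt_ker_of_det_eq_zero h
  exact h1.ne' (LinearMap.ker_eq_bot.2 (injective_fderiv_transition hg hd hM hz))

lemma col_eq_sum_jacobian {g d : E n → E m} (hg : IsGenerator g) (hd : IsGenerator d)
    (hM : range g = range d) {z : E n} (hz : z ∈ commonRegularSet g d) (i : Fin n) :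
    col d i z = ∑ k, jacobian (transition g d) z k i • col g k (transition g d z) := by
  rw [col, fderiv_eq_comp_fderiv_transition hg hd hM hz, ContinuousLinearMap.comp_apply,
    map_eq_sum_smul]
  rfl

lemma det_gram_col {g d : E n → E m} (hg : IsGenerator g) (hd : IsGenerator d)
    (hM : range g = range d) {z : E n} (hz : z ∈ commonRegularSet g d) :
    (Matrix.gram ℝ fun i => col d i z).det =
      (jacobian (transition g d) z).det ^ 2 *
        (Matrix.gram ℝ fun i => col g i (transition g d z)).det := by
  have h : (Matrix.gram ℝ fun i => col d i z) = (jacobian (transition g d) z).transpose *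
      (Matrix.gram ℝ fun i => col g i (transition g d z)) * jacobian (transition g d) z := by
    ext i j
    simp only [Matrix.gram_apply, Matrix.mul_apply, Matrix.transpose_apply,
      col_eq_sum_jacobian hg hd hM hz, sum_inner, inner_sum, real_inner_smul_left,
      real_inner_smul_right, Finset.sum_mul]
    refine Finset.sum_congr rfl fun k _ => Finset.sum_congr rfl fun l _ => ?_
    ring
  rw [h, Matrix.det_mul, Matrix.det_mul, Matrix.det_transpose]
  ring

lemma continuousOn_jacobian {g d : E n → E m} (hg : IsGenerator g) (hd : IsGenerator d)
    (hM : range g = range d) (k i : Fin n) :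
    ContinuousOn (fun z => jacobian (transition g d) z k i) (commonRegularSet g d) := by
  intro y hy
  have h1 : ContinuousAt (fderiv ℝ (transition g d)) y :=
    ((contDiffAt_transition hg hd hM hy).fderiv_right (m := 1) (by norm_num)).continuousAt
  have h2 : ContinuousAt (fun z => fderiv ℝ (transition g d) z (stdVec i)) y :=
    h1.clm_apply continuousAt_const
  exact ((EuclideanSpace.proj k : E n →L[ℝ] ℝ).continuous.continuousAt.comp
    h2).continuousWithinAt

/-! ### Transport of null sets and densities -/

lemma ae_transition {g d : E n → E m} (hg : IsGenerator g) (hd : IsGenerator d)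
    (hM : range g = range d) {Q : E n → Prop} (hQ : ∀ᵐ y : E n, Q y) :
    ∀ᵐ z : E n, z ∈ commonRegularSet g d → Q (transition g d z) := by
  rw [ae_iff] at hQ ⊢
  have h1 : volume ({y | ¬ Q y} ∩ commonRegularSet d g) = 0 :=
    measure_mono_null inter_subset_left hQ
  have h2 := addHaar_image_eq_zero_of_differentiableOn_of_addHaar_eq_zero volume
    (f := transition d g) (s := {y | ¬ Q y} ∩ commonRegularSet d g)
    (fun y hy => (differentiableAt_transition hd hg hM.symm hy.2).differentiableWithinAt) h1
  refine measure_mono_null (fun z hz => ?_) h2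
  simp only [mem_ofPred_eq, Classical.not_imp] at hz
  exact ⟨transition g d z, ⟨hz.2, transition_mem_commonRegularSet hd hM hz.1⟩,
    transition_transition hd.isEmbedding.injective hM z⟩

lemma measurable_priorDensity {p : Fin n → ℝ → ℝ} (hp : IsFactorPrior p) :
    Measurable (priorDensity p) := by
  unfold priorDensity
  refine Finset.measurable_prod _ fun i _ => (hp.measurable i).comp ?_
  exact (EuclideanSpace.proj i : E n →L[ℝ] ℝ).continuous.measurable

lemma priorDensity_nonneg {p : Fin n → ℝ → ℝ} (hp : IsFactorPrior p) (z : E n) :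
    0 ≤ priorDensity p z :=
  Finset.prod_nonneg fun i _ => hp.nonneg i _

lemma ae_mem_commonRegularSet {g d : E n → E m} {pg pd : Fin n → ℝ → ℝ}
    (hg : IsGenerator g) (hd : IsGenerator d) (hM : range g = range d)
    (hmatch : pushforward g pg = pushforward d pd) :
    ∀ᵐ z ∂(priorMeasure pd), z ∈ commonRegularSet g d := by
  have h1 : ∀ᵐ z ∂(priorMeasure pd), z ∈ regularSet d :=
    (withDensity_absolutelyContinuous _ _).ae_le hd.ae_regular
  have h2 : ∀ᵐ z ∂(priorMeasure pg), z ∈ regularSet g :=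
    (withDensity_absolutelyContinuous _ _).ae_le hg.ae_regular
  rw [← map_transition_priorMeasure hg hd hM hmatch] at h2
  have h3 := ae_of_ae_map (continuous_transition hg hd hM).measurable.aemeasurable h2
  filter_upwards [h1, h3] with z hz1 hz2 using ⟨hz1, hz2⟩

/-- The change of variables formula for the priors. -/
lemma ae_priorDensity_eq {g d : E n → E m} {pg pd : Fin n → ℝ → ℝ}
    (hg : IsGenerator g) (hd : IsGenerator d) (hpg : IsFactorPrior pg) (hpd : IsFactorPrior pd)
    (hM : range g = range d) (hmatch : pushforward g pg = pushforward d pd) :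
    ∀ᵐ z : E n, z ∈ commonRegularSet g d →
      priorDensity pd z =
        |(jacobian (transition g d) z).det| * priorDensity pg (transition g d z) := by
  have hW := isOpen_commonRegularSet hg hd hM
  have hφ := continuous_transition hg hd hM
  rw [← ae_restrict_iff' hW.measurableSet]
  have hdet : Measurable fun z : E n => (fderiv ℝ (transition g d) z).det :=
    ContinuousLinearMap.continuous_det.measurable.comp (measurable_fderiv ℝ _)
  have h : (fun z => ENNReal.ofReal (priorDensity pd z)) =ᵐ[volume.restrict (commonRegularSet g d)]
      fun z => ENNReal.ofReal |(fderiv ℝ (transition g d) z).det| *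
        ENNReal.ofReal (priorDensity pg (transition g d z)) := by
    refine ae_eq_of_forall_setLIntegral_eq_of_sigmaFinite
      (measurable_priorDensity hpd).ennreal_ofReal
      (hdet.abs.ennreal_ofReal.mul
        ((measurable_priorDensity hpg).comp hφ.measurable).ennreal_ofReal) fun s hs _ => ?_
    rw [Measure.restrict_restrict hs]
    have hsW : MeasurableSet (s ∩ commonRegularSet g d) := hs.inter hW.measurableSet
    have hinj : Function.Injective (transition g d) :=
      (isHomeomorph_transition hg hd hM).injective
    rw [← lintegral_image_eq_lintegral_abs_det_fderiv_mul volume hsW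
      (fun z hz => (differentiableAt_transition hg hd hM hz.2).hasFDerivAt.hasFDerivWithinAt)
      hinj.injOn (fun w => ENNReal.ofReal (priorDensity pg w))]
    have him : MeasurableSet (transition g d '' (s ∩ commonRegularSet g d)) :=
      (hφ.measurableEmbedding hinj).measurableSet_image.2 hsW
    rw [← withDensity_apply _ hsW, ← withDensity_apply _ him]
    change priorMeasure pd _ = priorMeasure pg _
    rw [← map_transition_priorMeasure hg hd hM hmatch, Measure.map_apply hφ.measurable him,
      preimage_image_eq _ hinj]
  filter_upwards [h] with z hz
  rw [det_jacobian]
  have h1 := congrArg ENNReal.toReal hz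
  rwa [ENNReal.toReal_mul, ENNReal.toReal_ofReal (priorDensity_nonneg hpd z),
    ENNReal.toReal_ofReal (abs_nonneg _), ENNReal.toReal_ofReal (priorDensity_nonneg hpg _)] at h1

lemma ae_manifoldDensity_eq {g d : E n → E m} {pg pd : Fin n → ℝ → ℝ}
    (hg : IsGenerator g) (hd : IsGenerator d) (hpg : IsFactorPrior pg) (hpd : IsFactorPrior pd)
    (hM : range g = range d) (hmatch : pushforward g pg = pushforward d pd) :
    ∀ᵐ z : E n, z ∈ commonRegularSet g d →
      manifoldDensity g pg (d z) = manifoldDensity d pd (d z) := by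
  filter_upwards [ae_priorDensity_eq hg hd hpg hpd hM hmatch] with z hz hzW
  have h1 : Function.invFun d (d z) = z := Function.leftInverse_invFun hd.isEmbedding.injective z
  have h2 : Function.invFun g (d z) = transition g d z := rfl
  rw [manifoldDensity, manifoldDensity, h1, h2, hz hzW, det_gram_col hg hd hM hzW,
    Real.sqrt_mul (sq_nonneg _), Real.sqrt_sq_eq_abs]
  rw [mul_div_mul_left _ _ (abs_ne_zero.2 (det_jacobian_ne_zero hg hd hM hzW))]

/-! ### Simple spectrum and the axis-aligned derivative -/

/-- A nonzero orthogonal family that diagonalises an operator with simple spectrum consists of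
multiples of the eigenbasis. -/
lemma exists_eq_smul_of_simple_spectrum {V : Type*} [NormedAddCommGroup V]
    [InnerProductSpace ℝ V] {H : V →ₗ[ℝ] V} {b : OrthonormalBasis (Fin n) ℝ V}
    {ev : Fin n → ℝ} (hev : Function.Injective ev)
    (hb : ∀ i, H (b i) = ev i • b i) {v : Fin n → V} (hv0 : ∀ i, v i ≠ 0)
    (hv : ∀ i j, i ≠ j → inner ℝ (v i) (v j) = 0)
    (hHv : ∀ i j, i ≠ j → inner ℝ (H (v i)) (v j) = 0) (i : Fin n) :
    ∃ (α : Fin n) (c : ℝ), v i = c • b α := by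
  have : FiniteDimensional ℝ V := b.toBasis.finiteDimensional_of_finite
  have hli : LinearIndependent ℝ v :=
    linearIndependent_of_ne_zero_of_inner_eq_zero hv0 fun i j hij => hv i j hij
  have hspan : Submodule.span ℝ (range v) = ⊤ :=
    hli.span_eq_top_of_card_eq_finrank' (Module.finrank_eq_card_basis b.toBasis).symm
  have hvv : inner ℝ (v i) (v i) ≠ 0 := inner_self_ne_zero.2 (hv0 i)
  set c : ℝ := inner ℝ (H (v i)) (v i) / inner ℝ (v i) (v i) with hc
  have heig : H (v i) = c • v i := by
    rw [← sub_eq_zero, ← inner_self_eq_zero (𝕜 := ℝ)]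
    have h0 : ∀ x ∈ Submodule.span ℝ (range v), inner ℝ (H (v i) - c • v i) x = 0 := by
      intro x hx
      induction hx using Submodule.span_induction with
      | mem x hx =>
        obtain ⟨j, rfl⟩ := hx
        rw [inner_sub_left, inner_smul_left]
        by_cases hij : i = j
        · subst hij
          rw [hc, RCLike.conj_to_real, div_mul_cancel₀ _ hvv, sub_self]
        · rw [hHv i j hij, hv i j hij]; simp
      | zero => simp
      | add x y _ _ hx hy => rw [inner_add_right, hx, hy, add_zero]
      | smul a x _ hx => rw [inner_smul_right, hx, mul_zero]
    exact h0 _ (hspan ▸ Submodule.mem_top)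
  have hcoef : ∀ k, ev k * b.repr (v i) k = c * b.repr (v i) k := by
    intro k
    have h1 : b.repr (H (v i)) k = c * b.repr (v i) k := by rw [heig]; simp
    rw [← h1]
    conv_rhs => rw [← b.sum_repr (v i)]
    simp [hb, b.repr_self, Pi.single_apply, mul_comm]
  obtain ⟨α, hα⟩ : ∃ α, b.repr (v i) α ≠ 0 := by
    by_contra! h
    exact hv0 i (by rw [← b.sum_repr (v i)]; simp [h])
  refine ⟨α, b.repr (v i) α, ?_⟩
  conv_lhs => rw [← b.sum_repr (v i)]
  refine Finset.sum_eq_single α (fun k _ hk => ?_) (by simp)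
  have h0 : b.repr (v i) k = 0 := by
    by_contra hne
    exact hk (hev ((mul_right_cancel₀ hne (hcoef k)).trans (mul_right_cancel₀ hα (hcoef α)).symm))
  rw [h0, zero_smul]

/-- A change of basis between two orthogonal families that diagonalise the same operator with
simple spectrum has at most one nonzero entry in each column. -/
lemma mul_eq_zero_of_simple_spectrum {V : Type*} [NormedAddCommGroup V]
    [InnerProductSpace ℝ V] {H : V →ₗ[ℝ] V}
    (hH : ∃ (b : OrthonormalBasis (Fin n) ℝ V) (ev : Fin n → ℝ), Function.Injective ev ∧
      ∀ i, H (b i) = ev i • b i) {v w : Fin n → V} (hv0 : ∀ i, v i ≠ 0) (hw0 : ∀ i, w i ≠ 0)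
    (hv : ∀ i j, i ≠ j → inner ℝ (v i) (v j) = 0) (hw : ∀ i j, i ≠ j → inner ℝ (w i) (w j) = 0)
    (hHv : ∀ i j, i ≠ j → inner ℝ (H (v i)) (v j) = 0)
    (hHw : ∀ i j, i ≠ j → inner ℝ (H (w i)) (w j) = 0)
    {M : Fin n → Fin n → ℝ} (hM : ∀ i, v i = ∑ k, M k i • w k)
    (i : Fin n) {k l : Fin n} (hkl : k ≠ l) : M k i * M l i = 0 := by
  obtain ⟨b, ev, hev, hb⟩ := hH
  obtain ⟨α, a, hα⟩ := exists_eq_smul_of_simple_spectrum hev hb hv0 hv hHv i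
  have hself : ∀ x : V, inner ℝ x x = ‖x‖ ^ 2 := fun x => real_inner_self_eq_norm_sq x
  have key : ∀ k, M k i ≠ 0 → ∃ c : ℝ, c ≠ 0 ∧ w k = c • b α := by
    intro k hk
    obtain ⟨β, c, hβ⟩ := exists_eq_smul_of_simple_spectrum hev hb hw0 hw hHw k
    have hc : c ≠ 0 := fun h => hw0 k (by rw [hβ, h, zero_smul])
    have h1 : inner ℝ (w k) (v i) = M k i * ‖w k‖ ^ 2 := by
      rw [hM i, inner_sum, Finset.sum_eq_single k]
      · rw [inner_smul_right, hself]
      · intro j _ hj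
        rw [inner_smul_right, hw k j hj.symm, mul_zero]
      · simp
    have h2 : inner ℝ (w k) (v i) ≠ 0 := by
      rw [h1]
      exact mul_ne_zero hk (pow_ne_zero 2 (norm_ne_zero_iff.2 (hw0 k)))
    refine ⟨c, hc, ?_⟩
    by_cases hβα : β = α
    · rw [hβ, hβα]
    · exfalso
      apply h2
      rw [hα, hβ, inner_smul_left, inner_smul_right, b.orthonormal.2 hβα]
      simp
  by_contra hne
  obtain ⟨hk, hl⟩ := mul_ne_zero_iff.1 hne
  obtain ⟨c, hc, hwk⟩ := key k hk
  obtain ⟨c', hc', hwl⟩ := key l hl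
  have h := hw k l hkl
  rw [hwk, hwl, inner_smul_left, inner_smul_right, hself, b.orthonormal.1 α] at h
  simp [hc, hc'] at h

lemma log_manifoldDensity {f : E n → E m} (hf : Function.Injective f)
    (hC : ∀ᵐ z : E n, C1At f z ∧ C2At f z) {p : Fin n → ℝ → ℝ}
    {z : E n} (hz : z ∈ regularSet f) (hpos : 0 < priorDensity p z) :
    Real.log (manifoldDensity f p (f z)) = ∑ i, Real.log (seamDensity f p i z) := by
  rw [manifoldDensity_eq_prod_seamDensity hf hC p hz, Real.log_prod]
  intro i _
  exact div_ne_zero (Finset.prod_ne_zero_iff.1 hpos.ne' i (Finset.mem_univ i))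
    (singVal_pos hz i).ne'

lemma ae_translate {Q : E n → Prop} (hQ : ∀ᵐ y : E n, Q y) (v : E n) :
    ∀ᵐ z : E n, Q (z + v) :=
  (measurePreserving_add_right volume v).quasiMeasurePreserving.ae hQ

/-- The tangent Hessian is diagonal in the seam directions at almost every point. The
factorisation of the density is only known almost everywhere, so the mixed differences are taken
with the countably many steps `1 / (k + 1)`. -/
lemma ae_inner_tangentHessian_eq_zero {f : E n → E m}
    (hC : ∀ᵐ z : E n, C1At f z ∧ C2At f z) {p : Fin n → ℝ → ℝ} {U : Set (E n)} (hU : IsOpen U)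
    (hUr : U ⊆ regularSet f) {ℓ : E m → ℝ}
    (hfac : ∀ᵐ y : E n, y ∈ U → ℓ (f y) = ∑ l, Real.log (seamDensity f p l y)) :
    ∀ᵐ z : E n, z ∈ U → ∀ (T : Submodule ℝ (E m)) (H : T →ₗ[ℝ] T), T = (fderiv ℝ f z).range →
      IsTangentHessian (range f) ℓ (f z) T H → ∀ i j, i ≠ j →
      inner ℝ (H (T.orthogonalProjectionOnto (col f i z)))
        (T.orthogonalProjectionOnto (col f j z)) = 0 := by
  set t : ℕ → ℝ := fun k => 1 / ((k : ℝ) + 1) with ht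
  have htlim : Tendsto t atTop (𝓝[≠] 0) :=
    tendsto_nhdsWithin_iff.2 ⟨tendsto_one_div_add_atTop_nhds_zero_nat,
      Eventually.of_forall fun k => (Nat.one_div_pos_of_nat (n := k)).ne'⟩
  have hall : ∀ᵐ z : E n, ∀ i j : Fin n, ∀ k : ℕ,
      ∀ v ∈ ({0, stdVec i, stdVec j, stdVec i + stdVec j} : Set (E n)),
      z + t k • v ∈ U → ℓ (f (z + t k • v)) =
        ∑ l, Real.log (seamDensity f p l (z + t k • v)) := by
    refine ae_all_iff.2 fun i => ae_all_iff.2 fun j => ae_all_iff.2 fun k => ?_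
    exact (ae_ball_iff (Set.toFinite _).countable).2 fun v _ => ae_translate hfac (t k • v)
  filter_upwards [hall] with z hz hzU T H hT hH i j hij
  refine inner_tangentHessian_eq_zero hC p (hUr hzU) hT hH hij htlim fun v hv => ?_
  have h1 : Tendsto (fun k => z + t k • v) atTop (𝓝 z) := by
    simpa using ((htlim.mono_right nhdsWithin_le_nhds).smul_const v).const_add z
  filter_upwards [h1 (hU.mem_nhds hzU)] with k hk using hz i j k v hv hk

lemma coe_orthogonalProjectionOnto_col {f : E n → E m} {z : E n} {T : Submodule ℝ (E m)}
    (hT : T = (fderiv ℝ f z).range) (i : Fin n) :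
    (T.orthogonalProjectionOnto (col f i z) : E m) = col f i z := by
  have h : col f i z ∈ T := hT ▸ ⟨stdVec i, rfl⟩
  exact congrArg Subtype.val (T.orthogonalProjectionOnto_mem_subspace_eq_self ⟨_, h⟩)

/-- At every common regular point each column of `Dφ` has at most one nonzero entry: the columns
of both Jacobians diagonalise the same tangent Hessian, which has simple spectrum, at almost
every point; the conclusion extends by continuity. -/
lemma jacobian_mul_eq_zero {g d : E n → E m} {pg pd : Fin n → ℝ → ℝ}
    (hg : IsGenerator g) (hd : IsGenerator d) (hpg : IsFactorPrior pg) (hpd : IsFactorPrior pd)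
    (hCg : ∀ᵐ z : E n, C1At g z ∧ C2At g z) (hCd : ∀ᵐ z : E n, C1At d z ∧ C2At d z)
    (hM : range g = range d) (hmatch : pushforward g pg = pushforward d pd)
    (hH : ∀ᵐ z : E n, 0 < priorDensity pg z ∧ HasSimpleTangentHessian g pg z)
    {z : E n} (hz : z ∈ commonRegularSet g d) (i : Fin n) {k l : Fin n} (hkl : k ≠ l) :
    jacobian (transition g d) z k i * jacobian (transition g d) z l i = 0 := by
  have hWo := isOpen_commonRegularSet hg hd hM
  refine eq_zero_of_ae_eq_zero hWo
    (F := fun z => jacobian (transition g d) z k i * jacobian (transition g d) z l i)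
    ((continuousOn_jacobian hg hd hM k i).mul (continuousOn_jacobian hg hd hM l i)) ?_ hz
  have hG := ae_inner_tangentHessian_eq_zero hCg (p := pg) (isOpen_regularSet g) Subset.rfl
    (ℓ := fun x => Real.log (manifoldDensity g pg x)) (by
      filter_upwards [hH] with y hy hyr
      exact log_manifoldDensity hg.isEmbedding.injective hCg hyr hy.1)
  have hD := ae_inner_tangentHessian_eq_zero hCd (p := pd) hWo (fun y hy => hy.1)
    (ℓ := fun x => Real.log (manifoldDensity g pg x)) (by
      filter_upwards [ae_manifoldDensity_eq hg hd hpg hpd hM hmatch,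
        ae_priorDensity_eq hg hd hpg hpd hM hmatch, ae_transition hg hd hM hH] with y h1 h2 h3 hy
      rw [h1 hy]
      refine log_manifoldDensity hd.isEmbedding.injective hCd hy.1 ?_
      rw [h2 hy]
      exact mul_pos (abs_pos.2 (det_jacobian_ne_zero hg hd hM hy)) (h3 hy).1)
  filter_upwards [hD, ae_transition hg hd hM hG, ae_transition hg hd hM hH] with y h1 h2 h3 hy
  obtain ⟨-, H, hHess, hspec⟩ := h3 hy
  have hT := range_fderiv_eq hg hd hM hy
  have e2 := h2 hy hy.2 _ H rfl hHess
  rw [apply_transition hM, hM] at hHess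
  have e1 := h1 hy _ H hT hHess
  have c1 := coe_orthogonalProjectionOnto_col (f := d) hT
  have c2 := coe_orthogonalProjectionOnto_col (f := g) (z := transition g d y) rfl
  refine mul_eq_zero_of_simple_spectrum hspec (v := fun i => _) (w := fun i => _)
    (fun i => ?_) (fun i => ?_)
    (fun i j hij => ?_) (fun i j hij => ?_) e1 e2 (fun i => ?_) i hkl
  · intro h
    exact col_ne_zero hy.1 i (by rw [← c1 i, h]; rfl)
  · intro h
    exact col_ne_zero hy.2 i (by rw [← c2 i, h]; rfl)
  · rw [Submodule.coe_inner, c1, c1]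
    exact inner_col_eq_zero hCd hy.1 hij
  · rw [Submodule.coe_inner, c2, c2]
    exact inner_col_eq_zero hCg hy.2 hij
  · rw [col_eq_sum_jacobian hg hd hM hy, map_sum]
    exact Finset.sum_congr rfl fun k _ => map_smul _ _ _

/-! ### The permutation and the signs on a connected set -/

lemma fderiv_stdVec_eq_sum_jacobian (φ : E n → E n) (z : E n) (i : Fin n) :
    fderiv ℝ φ z (stdVec i) = ∑ k, jacobian φ z k i • stdVec k :=
  eq_sum_smul_stdVec _

/-- Each column of `Dφ` has exactly one nonzero entry on `W`, and this entry is continuous; hence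
its position and sign are constant on connected subsets of `W`. -/
lemma exists_perm_sign {g d : E n → E m} (hg : IsGenerator g) (hd : IsGenerator d)
    (hM : range g = range d)
    (hmul : ∀ z ∈ commonRegularSet g d, ∀ i k l, k ≠ l →
      jacobian (transition g d) z k i * jacobian (transition g d) z l i = 0)
    {S : Set (E n)} (hS : IsPreconnected S) (hSW : S ⊆ commonRegularSet g d) {z₀ : E n}
    (hz₀ : z₀ ∈ S) :
    ∃ (σ : Equiv.Perm (Fin n)) (ε : Fin n → ℝ), (∀ i, ε i = 1 ∨ ε i = -1) ∧
      ∀ z ∈ S, ∀ i, ∃ a : ℝ, 0 < a ∧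
        fderiv ℝ (transition g d) z (stdVec i) = (ε i * a) • stdVec (σ i) := by
  set J := jacobian (transition g d) with hJ
  have hex : ∀ z ∈ commonRegularSet g d, ∀ i, ∃ k, J z k i ≠ 0 := by
    intro z hz i
    by_contra! h
    exact det_jacobian_ne_zero hg hd hM hz (Matrix.det_eq_zero_of_column_eq_zero i h)
  have hzero : ∀ z ∈ commonRegularSet g d, ∀ i k, J z k i ≠ 0 → ∀ l, l ≠ k → J z l i = 0 :=
    fun z hz i k hk l hl => (mul_eq_zero.1 (hmul z hz i k l hl.symm)).resolve_left hk
  have hloc : ∀ i, ∀ x ∈ S, ∀ᶠ y in 𝓝[S] x,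
      ∀ k, SignType.sign (J x k i) = SignType.sign (J y k i) := by
    intro i x hx
    obtain ⟨k, hk⟩ := hex x (hSW hx) i
    have hc : ContinuousWithinAt (fun y => SignType.sign (J y k i)) S x :=
      ContinuousAt.comp_continuousWithinAt (f := fun y => J y k i)
        (continuousAt_sign_of_ne_zero hk) ((continuousOn_jacobian hg hd hM k i x (hSW hx)).mono hSW)
    filter_upwards [hc.eventually (isOpen_discrete {SignType.sign (J x k i)} |>.mem_nhds rfl),
      self_mem_nhdsWithin] with y hy hyS l
    have hyk : SignType.sign (J y k i) = SignType.sign (J x k i) := hy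
    by_cases hl : l = k
    · rw [hl, hyk]
    · have hk' : J y k i ≠ 0 := by
        rw [← sign_ne_zero, hyk, sign_ne_zero]; exact hk
      rw [hzero x (hSW hx) i k hk l hl, hzero y (hSW hyS) i k hk' l hl]
  have hconst : ∀ z ∈ S, ∀ i k, SignType.sign (J z₀ k i) = SignType.sign (J z k i) := by
    intro z hz i
    exact hS.induction₂ (fun x y => ∀ k, SignType.sign (J x k i) = SignType.sign (J y k i))
      (hloc i) (fun x y z _ _ _ h1 h2 k => (h1 k).trans (h2 k))
      (fun x y _ _ h k => (h k).symm) hz₀ hz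
  choose κ hκ using hex z₀ (hSW hz₀)
  have hcolz : ∀ z ∈ S, ∀ i, fderiv ℝ (transition g d) z (stdVec i)
      = J z (κ i) i • stdVec (κ i) := by
    intro z hz i
    rw [fderiv_stdVec_eq_sum_jacobian]
    refine Finset.sum_eq_single (κ i) (fun l _ hl => ?_) (by simp)
    have hne : J z (κ i) i ≠ 0 := by
      rw [← sign_ne_zero, ← hconst z hz i, sign_ne_zero]; exact hκ i
    change J z l i • (stdVec l : E n) = 0
    rw [hzero z (hSW hz) i (κ i) hne l hl, zero_smul]
  have hinj : Function.Injective κ := by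
    intro i j hij
    by_contra hne
    have h1 : fderiv ℝ (transition g d) z₀
        (J z₀ (κ j) j • stdVec i - J z₀ (κ i) i • stdVec j) = 0 := by
      rw [map_sub, map_smul, map_smul, hcolz z₀ hz₀, hcolz z₀ hz₀, hij, smul_smul, smul_smul,
        mul_comm, sub_self]
    have h2 := injective_fderiv_transition hg hd hM (hSW hz₀) (h1.trans (map_zero _).symm)
    have h3 := congrArg (fun v : E n => v i) h2
    simp [stdVec_apply, hne] at h3
    exact hκ j h3
  refine ⟨Equiv.ofBijective κ (Finite.injective_iff_bijective.1 hinj),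
    fun i => (SignType.sign (J z₀ (κ i) i) : ℝ), fun i => ?_, fun z hz i =>
    ⟨|J z (κ i) i|, ?_, ?_⟩⟩
  · rcases lt_or_gt_of_ne (hκ i) with h | h
    · right; simp [sign_neg h]
    · left; simp [sign_pos h]
  · rw [abs_pos, ← sign_ne_zero, ← hconst z hz i, sign_ne_zero]
    exact hκ i
  · have h1 : (SignType.sign (J z₀ (κ i) i) : ℝ) * |J z (κ i) i| = J z (κ i) i := by
      rw [hconst z hz i, sign_mul_abs]
    rw [hcolz z hz]
    exact congrArg (fun c : ℝ => c • (stdVec (κ i) : E n)) h1.symm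

lemma col_eq_smul_col {g d : E n → E m} (hg : IsGenerator g)
    (hd : IsGenerator d) (hM : range g = range d) {z : E n} (hz : z ∈ commonRegularSet g d)
    {i k : Fin n} {c : ℝ} (h : fderiv ℝ (transition g d) z (stdVec i) = c • stdVec k) :
    col d i z = c • col g k (transition g d z) := by
  rw [col, fderiv_eq_comp_fderiv_transition hg hd hM hz, ContinuousLinearMap.comp_apply, h,
    map_smul]
  rfl

lemma singVal_eq_mul_singVal {g d : E n → E m} (hg : IsGenerator g)
    (hd : IsGenerator d) (hM : range g = range d) {z : E n} (hz : z ∈ commonRegularSet g d)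
    {i k : Fin n} {ε a : ℝ} (hε : ε = 1 ∨ ε = -1) (ha : 0 < a)
    (h : fderiv ℝ (transition g d) z (stdVec i) = (ε * a) • stdVec k) :
    singVal d i z = a * singVal g k (transition g d z) := by
  have hε' : |ε| = 1 := by rcases hε with h | h <;> simp [h]
  rw [singVal, col_eq_smul_col hg hd hM hz h, norm_smul, Real.norm_eq_abs, abs_mul, hε',
    abs_of_pos ha, one_mul, singVal]

lemma seamDir_eq_smul_seamDir {g d : E n → E m} (hg : IsGenerator g)
    (hd : IsGenerator d) (hM : range g = range d) {z : E n} (hz : z ∈ commonRegularSet g d)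
    {i k : Fin n} {ε a : ℝ} (hε : ε = 1 ∨ ε = -1) (ha : 0 < a)
    (h : fderiv ℝ (transition g d) z (stdVec i) = (ε * a) • stdVec k) :
    seamDir d i z = ε • seamDir g k (transition g d z) := by
  rw [seamDir, seamDir, singVal_eq_mul_singVal hg hd hM hz hε ha h, col_eq_smul_col hg hd hM hz h,
    smul_smul, smul_smul]
  congr 1
  have := (singVal_pos hz.2 k).ne'
  field_simp

/-! ### Seams are images of coordinate lines -/

lemma eq_of_hasDerivWithinAt_zero {F : Type*} [NormedAddCommGroup F] [NormedSpace ℝ F]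
    {y : ℝ → F} {T : ℝ} (h : ∀ t ∈ uIcc 0 T, HasDerivWithinAt y 0 (uIcc 0 T) t) {t : ℝ}
    (ht : t ∈ uIcc 0 T) : y t = y 0 := by
  have := (convex_uIcc (0 : ℝ) T).norm_image_sub_le_of_norm_hasDerivWithin_le (C := 0) h
    (by simp) left_mem_uIcc ht
  simpa [sub_eq_zero] using this

lemma hasDerivAt_add_smul (z v : E n) (t : ℝ) : HasDerivAt (fun t : ℝ => z + t • v) v t := by
  simpa using ((hasDerivAt_id t).smul_const v).const_add z

lemma singVal_smul_seamDir {f : E n → E m} {z : E n} (hz : z ∈ regularSet f) (i : Fin n) :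
    singVal f i z • seamDir f i z = col f i z := by
  rw [seamDir, smul_smul, mul_inv_cancel₀ (singVal_pos hz i).ne', one_smul]

/-- The integral curves of the `i`-th seam field are the images of the lines in direction `i`:
composed with a local left inverse of `f`, an integral curve has constant velocity `eᵢ`. -/
lemma mem_seam_iff {f : E n → E m} (hf : IsGenerator f) {V : Set (E n)} (hV : V ⊆ regularSet f)
    {i : Fin n} {z : E n} {x : E m} :
    x ∈ seam f (f '' V) i (f z) ↔
      ∃ T : ℝ, (∀ t ∈ uIcc 0 T, z + t • stdVec i ∈ V) ∧ x = f (z + T • stdVec i) := by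
  have hinv : ∀ y, Function.invFun f (f y) = y :=
    Function.leftInverse_invFun hf.isEmbedding.injective
  constructor
  · rintro ⟨γ, T, h0, hT, h⟩
    set y : ℝ → E n := fun t => Function.invFun f (γ t) with hy
    have hyV : ∀ t ∈ uIcc 0 T, y t ∈ V ∧ f (y t) = γ t := by
      intro t ht
      obtain ⟨w, hw, hwt⟩ := (h t ht).1
      have : y t = w := by rw [hy]; simp only [← hwt, hinv]
      rw [this]
      exact ⟨hw, hwt⟩
    have hder : ∀ t ∈ uIcc 0 T, HasDerivWithinAt y (stdVec i) (uIcc 0 T) t := by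
      intro t ht
      have hr := hV (hyV t ht).1
      have hγ := (h t ht).2
      change HasDerivWithinAt γ (singVal f i (y t) • seamDir f i (y t)) _ t at hγ
      rw [singVal_smul_seamDir hr] at hγ
      obtain ⟨L, hL, hLf⟩ := exists_contDiffAt_leftInverse hr
      have hLd : HasFDerivAt L (fderiv ℝ L (f (y t))) (f (y t)) :=
        (hL.differentiableAt (by norm_num)).hasFDerivAt
      have hLid : (fderiv ℝ L (f (y t))).comp (fderiv ℝ f (y t)) = ContinuousLinearMap.id ℝ _ :=
        ((hLd.comp (y t) (differentiableAt_of_mem_regularSet hr).hasFDerivAt)).unique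
          ((hasFDerivAt_id (y t)).congr_of_eventuallyEq hLf)
      have hyc : ContinuousWithinAt y (uIcc 0 T) t := by
        refine hf.isEmbedding.isInducing.tendsto_nhds_iff.2 ?_
        rw [(hyV t ht).2]
        refine hγ.continuousWithinAt.tendsto.congr' ?_
        filter_upwards [self_mem_nhdsWithin] with s hs using (hyV s hs).2.symm
      have h1 : HasDerivWithinAt (L ∘ γ) (stdVec i) (uIcc 0 T) t := by
        rw [(hyV t ht).2] at hLd
        have h2 := hLd.comp_hasDerivWithinAt t hγ
        have h3 : fderiv ℝ L (γ t) (col f i (y t)) = stdVec i := by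
          rw [← (hyV t ht).2]
          exact congrArg (fun A => A (stdVec i)) hLid
        rwa [h3] at h2
      refine h1.congr_of_eventuallyEq ?_ ?_
      · filter_upwards [hyc.eventually hLf, self_mem_nhdsWithin] with s hs hsT
        rw [Function.comp_apply, ← (hyV s hsT).2, hs]
      · rw [Function.comp_apply, ← (hyV t ht).2, hLf.self_of_nhds]
    have hy0 : y 0 = z := by rw [hy]; simp only [h0, hinv]
    have hline : ∀ t ∈ uIcc 0 T, y t = z + t • stdVec i := by
      intro t ht
      have h1 := eq_of_hasDerivWithinAt_zero (y := fun t => y t - (z + t • stdVec i)) (T := T)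
        (fun s hs => by
          have := (hder s hs).fun_sub (hasDerivAt_add_smul z (stdVec i) s).hasDerivWithinAt
          rwa [sub_self] at this) ht
      simp only [zero_smul, add_zero, hy0, sub_self] at h1
      exact sub_eq_zero.1 h1
    refine ⟨T, fun t ht => hline t ht ▸ (hyV t ht).1, ?_⟩
    rw [← hline T right_mem_uIcc, (hyV T right_mem_uIcc).2, hT]
  · rintro ⟨T, h, rfl⟩
    refine ⟨fun t => f (z + t • stdVec i), T, by simp, rfl, fun t ht =>
      ⟨mem_image_of_mem f (h t ht), ?_⟩⟩
    simp only [hinv]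
    rw [singVal_smul_seamDir (hV (h t ht))]
    exact ((differentiableAt_of_mem_regularSet (hV (h t ht))).hasFDerivAt.comp_hasDerivAt t
      (hasDerivAt_add_smul z (stdVec i) t)).hasDerivWithinAt

/-- If `Dφ` maps `eᵢ` to multiples of `eₖ` along a segment in direction `i`, then `φ` maps the
segment onto a set that contains the segment in direction `k` between the images of its ends. -/
lemma exists_segment_subset_image {φ : E n → E n} {W : Set (E n)} {i k : Fin n} {z : E n}
    {T : ℝ} (hW : ∀ t ∈ uIcc 0 T, z + t • stdVec i ∈ W)
    (hφ : ∀ t ∈ uIcc 0 T, DifferentiableAt ℝ φ (z + t • stdVec i))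
    (hder : ∀ t ∈ uIcc 0 T, ∃ c : ℝ, fderiv ℝ φ (z + t • stdVec i) (stdVec i) = c • stdVec k) :
    ∃ T' : ℝ, φ (z + T • stdVec i) = φ z + T' • stdVec k ∧
      ∀ s ∈ uIcc 0 T', φ z + s • stdVec k ∈ φ '' W := by
  set τ : ℝ → ℝ := fun t => φ (z + t • stdVec i) k - φ z k with hτ
  have hd : ∀ t ∈ uIcc 0 T, HasDerivAt (fun t : ℝ => φ (z + t • stdVec i))
      (fderiv ℝ φ (z + t • stdVec i) (stdVec i)) t := fun t ht =>
    (hφ t ht).hasFDerivAt.comp_hasDerivAt t (hasDerivAt_add_smul z (stdVec i) t)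
  have hdj : ∀ j, ∀ t ∈ uIcc 0 T, HasDerivAt (fun t : ℝ => φ (z + t • stdVec i) j)
      (fderiv ℝ φ (z + t • stdVec i) (stdVec i) j) t := fun j t ht =>
    (EuclideanSpace.proj j : E n →L[ℝ] ℝ).hasFDerivAt.comp_hasDerivAt t (hd t ht)
  have hline : ∀ t ∈ uIcc 0 T, φ (z + t • stdVec i) = φ z + τ t • stdVec k := by
    intro t ht
    ext j
    by_cases hj : j = k
    · subst hj
      simp [hτ, stdVec_apply]
    · have h := eq_of_hasDerivWithinAt_zero (y := fun t => φ (z + t • stdVec i) j) (T := T)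
        (fun s hs => by
          obtain ⟨c, hc⟩ := hder s hs
          have := (hdj j s hs).hasDerivWithinAt (s := uIcc 0 T)
          rw [hc] at this
          simpa [stdVec_apply, hj] using this) ht
      simpa [stdVec_apply, hj] using h
  refine ⟨τ T, hline T right_mem_uIcc, fun s hs => ?_⟩
  have hcont : ContinuousOn τ (uIcc 0 T) := fun t ht =>
    ((hdj k t ht).continuousAt.sub continuousAt_const).continuousWithinAt
  have h0 : τ 0 = 0 := by simp [hτ]
  obtain ⟨t, ht, rfl⟩ := intermediate_value_uIcc hcont (by rwa [h0])
  exact ⟨_, hW t ht, hline t ht⟩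

lemma image_eq_image_commonRegularSet {g d : E n → E m} (hg : IsGenerator g)
    (hd : IsGenerator d) (hM : range g = range d) :
    d '' commonRegularSet g d = g '' commonRegularSet d g := by
  rw [← image_commonRegularSet hg hd hM, image_image]
  simp only [apply_transition hM]

lemma seam_subset_seam {g d : E n → E m} (hg : IsGenerator g) (hd : IsGenerator d)
    (hM : range g = range d) {z : E n} {i k : Fin n}
    (hder : ∀ T : ℝ, (∀ t ∈ uIcc 0 T, z + t • stdVec i ∈ commonRegularSet g d) →
      ∃ c : ℝ, fderiv ℝ (transition g d) (z + T • stdVec i) (stdVec i) = c • stdVec k) :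
    seam d (d '' commonRegularSet g d) i (d z) ⊆ seam g (d '' commonRegularSet g d) k (d z) := by
  intro x hx
  obtain ⟨T, hT, rfl⟩ := (mem_seam_iff hd fun y hy => hy.1).1 hx
  rw [image_eq_image_commonRegularSet hg hd hM, ← apply_transition hM z,
    mem_seam_iff hg fun y hy => hy.1]
  obtain ⟨T', h1, h2⟩ := exists_segment_subset_image hT
    (fun t ht => differentiableAt_transition hg hd hM (hT t ht))
    (fun t ht => hder t fun s hs => hT s (uIcc_subset_uIcc_left ht hs))
  refine ⟨T', fun s hs => ?_, ?_⟩
  · rw [← image_commonRegularSet hg hd hM]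
    exact h2 s hs
  · rw [← h1, apply_transition hM]

lemma fderiv_transition_fderiv_transition {g d : E n → E m} (hg : IsGenerator g)
    (hd : IsGenerator d) (hM : range g = range d) {z : E n} (hz : z ∈ commonRegularSet g d)
    (v : E n) :
    fderiv ℝ (transition d g) (transition g d z) (fderiv ℝ (transition g d) z v) = v := by
  have h := (differentiableAt_transition hd hg hM.symm
    (transition_mem_commonRegularSet hd hM hz)).hasFDerivAt.comp z
    (differentiableAt_transition hg hd hM hz).hasFDerivAt
  have h2 : transition d g ∘ transition g d = id :=
    funext (transition_transition hd.isEmbedding.injective hM)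
  rw [h2] at h
  exact congrArg (fun A => A v) (h.unique (hasFDerivAt_id z))

lemma segment_subset_connectedComponentIn {W : Set (E n)} {z₀ z : E n}
    (hz : z ∈ connectedComponentIn W z₀) {y : ℝ → E n} (hy : Continuous y) (h0 : y 0 = z)
    {T : ℝ} (hT : ∀ t ∈ uIcc 0 T, y t ∈ W) : y T ∈ connectedComponentIn W z₀ := by
  rw [connectedComponentIn_eq hz]
  refine (isPreconnected_uIcc.image y hy.continuousOn).subset_connectedComponentIn
    ⟨0, left_mem_uIcc, h0⟩ ?_ ⟨T, right_mem_uIcc, rfl⟩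
  rintro _ ⟨t, ht, rfl⟩
  exact hT t ht

/-- Where `Dφ` is axis-aligned on a component of `W`, the seams of `d` and `g` agree. -/
lemma seam_eq_seam {g d : E n → E m} (hg : IsGenerator g) (hd : IsGenerator d)
    (hM : range g = range d) {z₀ z : E n} {i k : Fin n}
    (hz : z ∈ connectedComponentIn (commonRegularSet g d) z₀)
    (hder : ∀ y ∈ connectedComponentIn (commonRegularSet g d) z₀,
      ∃ c : ℝ, c ≠ 0 ∧ fderiv ℝ (transition g d) y (stdVec i) = c • stdVec k) :
    seam d (d '' commonRegularSet g d) i (d z) = seam g (d '' commonRegularSet g d) k (d z) := by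
  have hzz := transition_transition hd.isEmbedding.injective hM z
  refine Subset.antisymm (seam_subset_seam hg hd hM fun T hT => ?_) ?_
  · obtain ⟨c, -, hc⟩ := hder _ (segment_subset_connectedComponentIn hz
      (y := fun t => z + t • stdVec i) (by fun_prop) (by simp) hT)
    exact ⟨c, hc⟩
  · rw [image_eq_image_commonRegularSet hg hd hM, ← apply_transition hM z]
    refine seam_subset_seam hd hg hM.symm fun T hT => ?_
    have hw := segment_subset_connectedComponentIn hz
      (y := fun t => transition d g (transition g d z + t • stdVec k))
      ((continuous_transition hd hg hM.symm).comp (by fun_prop)) (by simpa using hzz)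
      (fun t ht => transition_mem_commonRegularSet hg hM.symm (hT t ht))
    obtain ⟨c, hc0, hc⟩ := hder _ hw
    have h := fderiv_transition_fderiv_transition hg hd hM
      (connectedComponentIn_subset _ _ hw) (stdVec i)
    rw [hc, transition_transition hg.isEmbedding.injective hM.symm, map_smul] at h
    exact ⟨c⁻¹, by rw [← h, smul_smul, inv_mul_cancel₀ hc0, one_smul]⟩

/-! ### Separation of variables almost everywhere -/

lemma exists_mem_of_isOpen_of_ae {α : Type*} [TopologicalSpace α] [MeasurableSpace α]
    [OpensMeasurableSpace α]
    {μ : Measure α} [μ.IsOpenPosMeasure] {U : Set α} (hU : IsOpen U) (hne : U.Nonempty)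
    {Q : α → Prop} (hQ : ∀ᵐ x ∂μ, x ∈ U → Q x) : ∃ x ∈ U, Q x :=
  Measure.exists_mem_of_measure_ne_zero_of_ae (hU.measure_pos μ hne).ne'
    ((ae_restrict_iff' hU.measurableSet).2 hQ)

/-- If a product of functions of one coordinate each is almost everywhere `1` on a box, then each
factor is almost everywhere constant: freeze all the other coordinates at a generic point. -/
lemma exists_ae_eq_const_of_prod_eq_one {I : Fin n → Set ℝ} (hIo : ∀ k, IsOpen (I k))
    (hIn : ∀ k, (I k).Nonempty) {ρ : Fin n → ℝ → ℝ}
    (h : ∀ᵐ x : Fin n → ℝ, (∀ k, x k ∈ I k) → ∏ k, ρ k (x k) = 1) (i : Fin n) :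
    ∃ c : ℝ, ∀ᵐ t : ℝ, t ∈ I i → ρ i t = c := by
  obtain _ | n := n
  · exact i.elim0
  have h1 := (volume_preserving_piFinSuccAbove (fun _ => ℝ) i).symm.quasiMeasurePreserving.ae h
  have h2 : ∀ᵐ p : (Fin n → ℝ) × ℝ, p.2 ∈ I i → (∀ j, p.1 j ∈ I (i.succAbove j)) →
      ρ i p.2 * ∏ j, ρ (i.succAbove j) (p.1 j) = 1 := by
    have h3 := (Measure.measurePreserving_swap (μ := (volume : Measure (Fin n → ℝ)))
      (ν := (volume : Measure ℝ))).quasiMeasurePreserving.ae h1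
    filter_upwards [h3] with p hp hp2 hp1
    have hp' : (∀ k, i.insertNth (α := fun _ => ℝ) p.2 p.1 k ∈ I k) →
        ∏ k, ρ k (i.insertNth (α := fun _ => ℝ) p.2 p.1 k) = 1 := hp
    have := hp' (by
      intro k
      rcases Fin.eq_self_or_eq_succAbove i k with rfl | ⟨j, rfl⟩
      · simpa using hp2
      · simpa using hp1 j)
    rw [Fin.prod_univ_succAbove _ i] at this
    simpa using this
  have h4 := Measure.ae_ae_of_ae_prod h2
  have hopen : IsOpen {y : Fin n → ℝ | ∀ j, y j ∈ I (i.succAbove j)} := by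
    have : {y : Fin n → ℝ | ∀ j, y j ∈ I (i.succAbove j)} =
        univ.pi fun j => I (i.succAbove j) := by ext; simp
    rw [this]
    exact isOpen_set_pi finite_univ fun j _ => hIo _
  obtain ⟨y, hyI, hy⟩ := exists_mem_of_isOpen_of_ae (μ := (volume : Measure (Fin n → ℝ))) hopen
    ⟨fun j => (hIn _).choose, fun j => (hIn _).choose_spec⟩ (h4.mono fun y hy _ => hy)
  refine ⟨(∏ j, ρ (i.succAbove j) (y j))⁻¹, ?_⟩
  filter_upwards [hy] with t ht htI
  exact eq_inv_of_mul_eq_one_left (ht htI hyI)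

lemma ae_apply_of_ae {Q : ℝ → Prop} (h : ∀ᵐ t : ℝ, Q t) (i : Fin n) : ∀ᵐ z : E n, Q (z i) := by
  have h1 := (Measure.quasiMeasurePreserving_eval (fun _ : Fin n => (volume : Measure ℝ)) i).ae h
  exact (PiLp.volume_preserving_ofLp (Fin n)).quasiMeasurePreserving.ae h1

lemma ae_of_ae_apply {Q : ℝ → Prop} {i : Fin n} (h : ∀ᵐ z : E n, Q (z i)) : ∀ᵐ t : ℝ, Q t := by
  have h0 : ∀ᵐ x : Fin n → ℝ, Q (x i) :=
    (PiLp.volume_preserving_toLp (Fin n)).quasiMeasurePreserving.ae h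
  obtain _ | n := n
  · exact i.elim0
  have h1 := (volume_preserving_piFinSuccAbove (fun _ => ℝ) i).symm.quasiMeasurePreserving.ae h0
  filter_upwards [Measure.ae_ae_of_ae_prod h1] with t ht
  obtain ⟨y, hy⟩ := ht.exists
  have hy' : Q (i.insertNth (α := fun _ => ℝ) t y i) := hy
  rwa [Fin.insertNth_apply_same] at hy'

/-- A function that is almost everywhere constant near each point of a connected set is
almost everywhere constant on it. -/
lemma exists_ae_eq_const_of_locally {Ω : Set (E n)} (hΩc : IsPreconnected Ω)
    (hne : Ω.Nonempty) {r : E n → ℝ}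
    (h : ∀ z ∈ Ω, ∃ U, IsOpen U ∧ z ∈ U ∧ ∃ c : ℝ, ∀ᵐ y : E n, y ∈ U → r y = c) :
    ∃ c : ℝ, ∀ᵐ y : E n, y ∈ Ω → r y = c := by
  choose! U hUo hzU c hc using h
  have hloc : ∀ x ∈ Ω, ∀ y ∈ Ω, y ∈ U x → c x = c y := by
    intro x hx y hy hyU
    obtain ⟨w, -, hw⟩ := exists_mem_of_isOpen_of_ae (μ := (volume : Measure (E n)))
      ((hUo x hx).inter (hUo y hy)) ⟨y, hyU, hzU y hy⟩
      (Q := fun w => c x = c y) (by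
        filter_upwards [hc x hx, hc y hy] with w h1 h2 hw
        rw [← h1 hw.1, ← h2 hw.2])
    exact hw
  obtain ⟨z₀, hz₀⟩ := hne
  have hconst : ∀ z ∈ Ω, c z₀ = c z := fun z hz =>
    hΩc.induction₂ (fun x y => c x = c y)
      (fun x hx => by
        filter_upwards [self_mem_nhdsWithin,
          nhdsWithin_le_nhds ((hUo x hx).mem_nhds (hzU x hx))] with y hy hyU
        exact hloc x hx y hy hyU)
      (fun _ _ _ _ _ _ => Eq.trans) (fun _ _ _ _ => Eq.symm) hz₀ hz
  refine ⟨c z₀, ?_⟩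
  rw [ae_iff]
  refine measure_null_of_locally_null _ fun z hz => ?_
  simp only [mem_ofPred_eq, Classical.not_imp] at hz
  refine ⟨U z ∩ {y | ¬ (y ∈ Ω → r y = c z₀)}, ?_, ?_⟩
  · exact inter_mem (nhdsWithin_le_nhds ((hUo z hz.1).mem_nhds (hzU z hz.1)))
      self_mem_nhdsWithin
  · refine measure_mono_null (fun y hy => ?_) (ae_iff.1 (hc z hz.1))
    simp only [mem_inter_iff, mem_ofPred_eq, Classical.not_imp] at hy ⊢
    exact ⟨hy.1, hconst z hz.1 ▸ hy.2.2⟩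

/-! ### The ratios of the seam densities -/

/-- Where `φ` is axis-aligned, a function of the `σ i`-th coordinate of `φ` is a function of the
`i`-th coordinate. -/
lemma comp_eq_of_apply_eq {φ : E n → E n} {U : Set (E n)} (hU : Convex ℝ U)
    {σ : Equiv.Perm (Fin n)} (hφ : ∀ y ∈ U, DifferentiableAt ℝ φ y)
    (hder : ∀ y ∈ U, ∀ i, ∃ c : ℝ, fderiv ℝ φ y (stdVec i) = c • stdVec (σ i))
    {i : Fin n} {G : E n → ℝ} {G' : E n → E n →L[ℝ] ℝ}
    (hG : ∀ y ∈ U, HasFDerivAt G (G' (φ y)) (φ y))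
    (hG' : ∀ y ∈ U, ∀ l, l ≠ σ i → G' (φ y) (stdVec l) = 0) {y y' : E n} (hy : y ∈ U)
    (hy' : y' ∈ U) (hi : y i = y' i) : G (φ y) = G (φ y') := by
  refine eq_of_apply_eq_of_fderiv_eq_zero hU (F := fun y => G (φ y))
    (F' := fun y => (G' (φ y)).comp (fderiv ℝ φ y))
    (fun w hw => (hG w hw).comp w (hφ w hw).hasFDerivAt) (fun w hw j hj => ?_) hy hy' hi
  obtain ⟨c, hc⟩ := hder w hw j
  rw [ContinuousLinearMap.comp_apply, hc, map_smul, hG' w hw _ fun h => hj (σ.injective h),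
    smul_zero]

lemma apply_perm_eq_of_apply_eq {φ : E n → E n} {U : Set (E n)} (hU : Convex ℝ U)
    {σ : Equiv.Perm (Fin n)} (hφ : ∀ y ∈ U, DifferentiableAt ℝ φ y)
    (hder : ∀ y ∈ U, ∀ i, ∃ c : ℝ, fderiv ℝ φ y (stdVec i) = c • stdVec (σ i))
    {i : Fin n} {y y' : E n} (hy : y ∈ U) (hy' : y' ∈ U) (hi : y i = y' i) :
    φ y (σ i) = φ y' (σ i) :=
  comp_eq_of_apply_eq hU hφ hder (G := fun y => y (σ i))
    (G' := fun _ => (EuclideanSpace.proj (σ i) : E n →L[ℝ] ℝ))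
    (fun _ _ => (EuclideanSpace.proj (σ i) : E n →L[ℝ] ℝ).hasFDerivAt)
    (fun _ _ l hl => by simp [stdVec_apply, hl.symm]) hy hy' hi

lemma seamDensity_transition_eq_of_apply_eq {g : E n → E m}
    (hCg : ∀ᵐ z : E n, C1At g z ∧ C2At g z) (p : Fin n → ℝ → ℝ)
    {φ : E n → E n} {U : Set (E n)} (hU : Convex ℝ U)
    {σ : Equiv.Perm (Fin n)} (hφ : ∀ y ∈ U, DifferentiableAt ℝ φ y)
    (hφr : ∀ y ∈ U, φ y ∈ regularSet g)
    (hder : ∀ y ∈ U, ∀ i, ∃ c : ℝ, fderiv ℝ φ y (stdVec i) = c • stdVec (σ i))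
    {i : Fin n} {y y' : E n} (hy : y ∈ U) (hy' : y' ∈ U) (hi : y i = y' i) :
    seamDensity g p (σ i) (φ y) = seamDensity g p (σ i) (φ y') := by
  have h := comp_eq_of_apply_eq hU hφ hder (i := i)
    (G' := fun x => 2 • (innerSL ℝ (col g (σ i) x)).comp (fderiv ℝ (col g (σ i)) x))
    (fun w hw => hasFDerivAt_singVal_sq (hφr w hw) (σ i))
    (fun w hw l hl => fderiv_singVal_sq_eq_zero hCg (hφr w hw) hl) hy hy' hi
  have h2 : singVal g (σ i) (φ y) = singVal g (σ i) (φ y') :=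
    (sq_eq_sq₀ (singVal_pos (hφr y hy) _).le (singVal_pos (hφr y' hy') _).le).1 h
  rw [seamDensity, seamDensity, h2, apply_perm_eq_of_apply_eq hU hφ hder hy hy' hi]

/-- Separation of variables on a small box. -/
lemma exists_nhd_ae_eq_const {Ω : Set (E n)} (hΩ : IsOpen Ω) {r : Fin n → E n → ℝ}
    (hr : ∀ U ⊆ Ω, Convex ℝ U → ∀ k, ∀ y ∈ U, ∀ y' ∈ U, y k = y' k → r k y = r k y')
    (hprod : ∀ᵐ z : E n, z ∈ Ω → ∏ k, r k z = 1) {z : E n} (hz : z ∈ Ω) (i : Fin n) :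
    ∃ U, IsOpen U ∧ z ∈ U ∧ ∃ c : ℝ, ∀ᵐ y : E n, y ∈ U → r i y = c := by
  have hto : Continuous (WithLp.toLp 2 : (Fin n → ℝ) → E n) := PiLp.continuous_toLp 2 _
  have hof : Continuous (WithLp.ofLp : E n → (Fin n → ℝ)) := PiLp.continuous_ofLp 2 _
  obtain ⟨δ, hδ, hball⟩ := Metric.isOpen_iff.1 (hΩ.preimage hto) z.ofLp hz
  set U : Set (E n) := WithLp.ofLp ⁻¹' Metric.ball z.ofLp δ with hU
  have hUΩ : U ⊆ Ω := fun y hy => hball hy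
  have hUo : IsOpen U := Metric.isOpen_ball.preimage hof
  have hzU : z ∈ U := Metric.mem_ball_self (x := z.ofLp) hδ
  have hUc : Convex ℝ U :=
    (convex_ball z.ofLp δ).linear_preimage (WithLp.linearEquiv 2 ℝ (Fin n → ℝ)).toLinearMap
  have hmem : ∀ y : E n, y ∈ U ↔ ∀ k, y k ∈ Metric.ball (z k) δ := by
    intro y
    rw [hU, mem_preimage, ball_pi _ hδ]
    simp
  -- each `r k` as a function of its own coordinate
  set ρ : Fin n → ℝ → ℝ := fun k t => r k (WithLp.toLp 2 (Function.update z.ofLp k t)) with hρ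
  have hrρ : ∀ k, ∀ y ∈ U, r k y = ρ k (y k) := by
    intro k y hy
    refine hr U hUΩ hUc k y hy _ ((hmem _).2 fun l => ?_) (by simp)
    by_cases hl : l = k
    · subst hl; simpa using (hmem y).1 hy l
    · simpa [hl] using hδ
  have h1 : ∀ᵐ x : Fin n → ℝ, (∀ k, x k ∈ Metric.ball (z k) δ) → ∏ k, ρ k (x k) = 1 := by
    have h2 := (PiLp.volume_preserving_toLp (Fin n)).quasiMeasurePreserving.ae hprod
    filter_upwards [h2] with x hx hxI
    have hxU : WithLp.toLp 2 x ∈ U := (hmem _).2 hxI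
    rw [← hx (hUΩ hxU)]
    exact Finset.prod_congr rfl fun k _ => (hrρ k _ hxU).symm
  obtain ⟨c, hc⟩ := exists_ae_eq_const_of_prod_eq_one (fun k => Metric.isOpen_ball)
    (fun k => ⟨z k, Metric.mem_ball_self hδ⟩) h1 i
  refine ⟨U, hUo, hzU, c, ?_⟩
  filter_upwards [ae_apply_of_ae hc i] with y hy hyU
  rw [hrρ i y hyU, hy ((hmem y).1 hyU i)]

lemma seamDensity_pos {f : E n → E m} {p : Fin n → ℝ → ℝ} (hp : IsFactorPrior p) {z : E n}
    (hz : z ∈ regularSet f) (hpos : 0 < priorDensity p z) (i : Fin n) :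
    0 < seamDensity f p i z :=
  div_pos (lt_of_le_of_ne (hp.nonneg i _)
    (Finset.prod_ne_zero_iff.1 hpos.ne' i (Finset.mem_univ i)).symm) (singVal_pos hz i)

/-- On a connected open part of `W`, corresponding seam densities of `d` and `g` have constant
ratios: the ratios are functions of one coordinate each and their product is `1`. -/
lemma exists_seamDensity_eq_mul {g d : E n → E m} {pg pd : Fin n → ℝ → ℝ}
    (hg : IsGenerator g) (hd : IsGenerator d) (hpg : IsFactorPrior pg) (hpd : IsFactorPrior pd)
    (hCg : ∀ᵐ z : E n, C1At g z ∧ C2At g z) (hCd : ∀ᵐ z : E n, C1At d z ∧ C2At d z)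
    (hM : range g = range d) (hmatch : pushforward g pg = pushforward d pd)
    (hpos : ∀ᵐ z : E n, 0 < priorDensity pg z)
    {Ω : Set (E n)} (hΩ : IsOpen Ω) (hΩc : IsPreconnected Ω) (hne : Ω.Nonempty)
    (hΩW : Ω ⊆ commonRegularSet g d) {σ : Equiv.Perm (Fin n)}
    (hder : ∀ y ∈ Ω, ∀ i, ∃ c : ℝ,
      fderiv ℝ (transition g d) y (stdVec i) = c • stdVec (σ i)) :
    ∃ c : Fin n → ℝ, (∀ i, 0 < c i) ∧ ∏ i, c i = 1 ∧
      ∀ᵐ z : E n, z ∈ Ω → ∀ i,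
        seamDensity d pd i z = c i * seamDensity g pg (σ i) (transition g d z) := by
  set r : Fin n → E n → ℝ := fun i z =>
    seamDensity d pd i z / seamDensity g pg (σ i) (transition g d z) with hr
  have hrpos : ∀ᵐ z : E n, z ∈ Ω → (∀ i, 0 < seamDensity g pg (σ i) (transition g d z)) ∧
      (∀ i, 0 < r i z) ∧ ∏ i, r i z = 1 := by
    filter_upwards [ae_transition hg hd hM hpos, ae_priorDensity_eq hg hd hpg hpd hM hmatch,
      ae_manifoldDensity_eq hg hd hpg hpd hM hmatch] with z h1 h2 h3 hzΩ
    have hz := hΩW hzΩ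
    have hgpos : ∀ i, 0 < seamDensity g pg i (transition g d z) :=
      seamDensity_pos hpg hz.2 (h1 hz)
    have hdpos : ∀ i, 0 < seamDensity d pd i z := seamDensity_pos hpd hz.1 (by
      rw [h2 hz]
      exact mul_pos (abs_pos.2 (det_jacobian_ne_zero hg hd hM hz)) (h1 hz))
    refine ⟨fun i => hgpos _, fun i => div_pos (hdpos i) (hgpos _), ?_⟩
    have h4 := h3 hz
    rw [manifoldDensity_eq_prod_seamDensity hd.isEmbedding.injective hCd pd hz.1,
      ← apply_transition hM z,
      manifoldDensity_eq_prod_seamDensity hg.isEmbedding.injective hCg pg hz.2] at h4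
    rw [hr, Finset.prod_div_distrib, ← h4,
      Equiv.prod_comp σ fun i => seamDensity g pg i (transition g d z)]
    exact div_self (Finset.prod_pos fun i _ => hgpos i).ne'
  have hconst : ∀ i, ∃ c : ℝ, ∀ᵐ z : E n, z ∈ Ω → r i z = c := by
    intro i
    refine exists_ae_eq_const_of_locally hΩc hne fun z hz => ?_
    refine exists_nhd_ae_eq_const hΩ (r := r) (fun U hUΩ hU k y hy y' hy' hk => ?_)
      (hrpos.mono fun z h hz => (h hz).2.2) hz i
    have hUW := hUΩ.trans hΩW
    simp only [hr]
    rw [seamDensity_eq_of_apply_eq hCd pd hU (fun w hw => (hUW hw).1) hy hy' hk,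
      seamDensity_transition_eq_of_apply_eq hCg pg hU
        (fun w hw => differentiableAt_transition hg hd hM (hUW hw)) (fun w hw => (hUW hw).2)
        (fun w hw => hder w (hUΩ hw)) hy hy' hk]
  choose c hc using hconst
  have hall : ∀ᵐ z : E n, z ∈ Ω → ∀ i, r i z = c i := by
    filter_upwards [ae_all_iff.2 hc] with z hz hzΩ i using hz i hzΩ
  obtain ⟨w, hwΩ, hw⟩ := exists_mem_of_isOpen_of_ae hΩ hne (hrpos.and hall |>.mono
    fun z h hz => (⟨h.1 hz, h.2 hz⟩ : _ ∧ _))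
  refine ⟨c, fun i => ?_, ?_, ?_⟩
  · rw [← hw.2 i]
    exact hw.1.2.1 i
  · rw [← hw.1.2.2]
    exact Finset.prod_congr rfl fun i _ => (hw.2 i).symm
  · filter_upwards [hrpos, hall] with z h1 h2 hz i
    rw [← h2 hz i, hr]
    exact (div_mul_cancel₀ _ ((h1 hz).1 i).ne').symm

/-! ### Agreement on connected components -/

/-- The seam decompositions of `d` and `g` agree on each connected component of `W`. -/
lemma exists_perm_sign_const {g d : E n → E m} {pg pd : Fin n → ℝ → ℝ}
    (hg : IsGenerator g) (hd : IsGenerator d) (hpg : IsFactorPrior pg) (hpd : IsFactorPrior pd)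
    (hCg : ∀ᵐ z : E n, C1At g z ∧ C2At g z) (hCd : ∀ᵐ z : E n, C1At d z ∧ C2At d z)
    (hM : range g = range d) (hmatch : pushforward g pg = pushforward d pd)
    (hH : ∀ᵐ z : E n, 0 < priorDensity pg z ∧ HasSimpleTangentHessian g pg z)
    {z₀ : E n} (hz₀ : z₀ ∈ commonRegularSet g d) :
    ∃ (σ : Equiv.Perm (Fin n)) (ε : Fin n → ℝ) (c : Fin n → ℝ),
      (∀ i, ε i = 1 ∨ ε i = -1) ∧ (∀ i, 0 < c i) ∧ ∏ i, c i = 1 ∧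
      (∀ z ∈ connectedComponentIn (commonRegularSet g d) z₀, ∀ i,
        seamDir d i z = ε i • seamDir g (σ i) (transition g d z) ∧
        seam d (d '' commonRegularSet g d) i (d z) =
          seam g (d '' commonRegularSet g d) (σ i) (d z) ∧
        ∃ a : ℝ, 0 < a ∧
          fderiv ℝ (transition g d) z (stdVec i) = (ε i * a) • stdVec (σ i)) ∧
      (∀ᵐ z : E n, z ∈ connectedComponentIn (commonRegularSet g d) z₀ → ∀ i,
        seamDensity d pd i z = c i * seamDensity g pg (σ i) (transition g d z)) := by
  set Ω := connectedComponentIn (commonRegularSet g d) z₀ with hΩ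
  have hΩW : Ω ⊆ commonRegularSet g d := connectedComponentIn_subset _ _
  have hz₀Ω : z₀ ∈ Ω := mem_connectedComponentIn hz₀
  obtain ⟨σ, ε, hε, hder⟩ := exists_perm_sign hg hd hM
    (fun z hz i k l hkl => jacobian_mul_eq_zero hg hd hpg hpd hCg hCd hM hmatch hH hz i hkl)
    isPreconnected_connectedComponentIn hΩW hz₀Ω
  obtain ⟨c, hc0, hc1, hc⟩ := exists_seamDensity_eq_mul hg hd hpg hpd hCg hCd hM hmatch
    (hH.mono fun z hz => hz.1) (isOpen_commonRegularSet hg hd hM).connectedComponentIn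
    isPreconnected_connectedComponentIn ⟨z₀, hz₀Ω⟩ hΩW
    (fun y hy i => (hder y hy i).imp' (fun a => ε i * a) fun a h => h.2)
  refine ⟨σ, ε, c, hε, hc0, hc1, fun z hz i => ?_, hc⟩
  obtain ⟨a, ha, hda⟩ := hder z hz i
  refine ⟨seamDir_eq_smul_seamDir hg hd hM (hΩW hz) (hε i) ha hda,
    seam_eq_seam hg hd hM hz fun y hy => ?_, a, ha, hda⟩
  obtain ⟨b, hb, hdb⟩ := hder y hy i
  refine ⟨ε i * b, mul_ne_zero ?_ hb.ne', hdb⟩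
  rcases hε i with h | h <;> simp [h]

/-! ### The global form -/

/-- A change of variables on the line that is known up to a constant factor between two
probability densities holds with factor `1`. -/
lemma map_factorMeasure_eq {p q : Fin n → ℝ → ℝ} (hp : IsFactorPrior p) (hq : IsFactorPrior q)
    {i k : Fin n} {h h' : ℝ → ℝ} (hh : ∀ t, HasDerivAt h (h' t) t) (hbij : Function.Bijective h)
    {c : ℝ} (hc : 0 < c) (hpq : ∀ᵐ t : ℝ, p i t = c * (|h' t| * q k (h t))) :
    c = 1 ∧ (factorMeasure p i).map h = factorMeasure q k := by
  have hcont : Continuous h := continuous_iff_continuousAt.2 fun t => (hh t).continuousAt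
  have hint : ∀ S : Set ℝ, MeasurableSet S →
      ∫⁻ t in h ⁻¹' S, ENNReal.ofReal (p i t) =
        ENNReal.ofReal c * ∫⁻ t in S, ENNReal.ofReal (q k t) := by
    intro S hS
    have h1 := lintegral_image_eq_lintegral_abs_deriv_mul (hcont.measurable hS)
      (fun t _ => (hh t).hasDerivWithinAt) hbij.1.injOn (fun t => ENNReal.ofReal (q k t))
    rw [image_preimage_eq S hbij.2] at h1
    rw [h1, ← lintegral_const_mul' _ _ ENNReal.ofReal_ne_top]
    refine lintegral_congr_ae (ae_restrict_of_ae ?_)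
    filter_upwards [hpq] with t ht
    rw [ht, ENNReal.ofReal_mul hc.le, ENNReal.ofReal_mul (abs_nonneg _)]
  have hc1 : c = 1 := by
    have h1 := hint univ MeasurableSet.univ
    rw [preimage_univ, setLIntegral_univ, setLIntegral_univ, hp.lintegral_eq_one,
      hq.lintegral_eq_one, mul_one] at h1
    rw [← ENNReal.toReal_ofReal hc.le, ← h1, ENNReal.toReal_one]
  refine ⟨hc1, Measure.ext fun S hS => ?_⟩
  rw [Measure.map_apply hcont.measurable hS, factorMeasure, factorMeasure,
    withDensity_apply _ (hcont.measurable hS), withDensity_apply _ hS, hint S hS, hc1]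
  simp

/-- The one-dimensional components of a map that is everywhere axis-aligned. -/
noncomputable def axisMap (φ : E n → E n) (σ : Equiv.Perm (Fin n)) (i : Fin n) (t : ℝ) : ℝ :=
  φ (t • stdVec i) (σ i)

lemma apply_eq_axisMap {φ : E n → E n} {σ : Equiv.Perm (Fin n)} (hφ : Differentiable ℝ φ)
    (hder : ∀ y i, ∃ c : ℝ, fderiv ℝ φ y (stdVec i) = c • stdVec (σ i)) (z : E n) (i : Fin n) :
    φ z (σ i) = axisMap φ σ i (z i) :=
  apply_perm_eq_of_apply_eq convex_univ (fun y _ => hφ y) (fun y _ => hder y)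
    (mem_univ _) (mem_univ _) (by simp [stdVec_apply])

lemma hasDerivAt_axisMap {φ : E n → E n} {σ : Equiv.Perm (Fin n)} (hφ : Differentiable ℝ φ)
    (hder : ∀ y i, ∃ c : ℝ, fderiv ℝ φ y (stdVec i) = c • stdVec (σ i)) {z : E n} {i : Fin n}
    {c : ℝ} (hc : fderiv ℝ φ z (stdVec i) = c • stdVec (σ i)) :
    HasDerivAt (axisMap φ σ i) c (z i) := by
  have h1 : HasDerivAt (fun s : ℝ => z + (s - z i) • (stdVec i : E n)) (stdVec i) (z i) := by
    simpa using (((hasDerivAt_id (z i)).sub_const (z i)).smul_const (stdVec i)).const_add z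
  have h0 : z + (z i - z i) • (stdVec i : E n) = z := by simp
  have h2 : HasFDerivAt φ (fderiv ℝ φ z) (z + (z i - z i) • (stdVec i : E n)) := by
    rw [h0]; exact (hφ z).hasFDerivAt
  have h3 := (EuclideanSpace.proj (σ i) : E n →L[ℝ] ℝ).hasFDerivAt.comp_hasDerivAt (z i)
    (h2.comp_hasDerivAt (z i) h1)
  rw [hc] at h3
  have h4 : axisMap φ σ i = fun s => φ (z + (s - z i) • stdVec i) (σ i) := by
    ext s
    rw [apply_eq_axisMap hφ hder]
    simp [stdVec_apply]
  have h5 : (EuclideanSpace.proj (σ i) : E n →L[ℝ] ℝ) (c • stdVec (σ i)) = c := by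
    simp [stdVec_apply]
  rw [h5] at h3
  rw [h4]
  exact h3

lemma bijective_axisMap {φ : E n → E n} {σ : Equiv.Perm (Fin n)} (hφ : Differentiable ℝ φ)
    (hder : ∀ y i, ∃ c : ℝ, fderiv ℝ φ y (stdVec i) = c • stdVec (σ i))
    (hbij : Function.Bijective φ) (i : Fin n) : Function.Bijective (axisMap φ σ i) := by
  constructor
  · intro s t hst
    have h1 : φ (s • stdVec i) = φ (t • stdVec i) := by
      ext k
      obtain ⟨j, rfl⟩ := σ.surjective k
      rw [apply_eq_axisMap hφ hder, apply_eq_axisMap hφ hder]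
      by_cases hj : j = i
      · subst hj; simpa [stdVec_apply] using hst
      · simp [stdVec_apply, hj]
    have h2 := congrArg (fun v : E n => v i) (hbij.1 h1)
    simpa [stdVec_apply] using h2
  · intro s
    obtain ⟨z, hz⟩ := hbij.2 (s • stdVec (σ i))
    exact ⟨z i, by rw [← apply_eq_axisMap hφ hder, hz]; simp [stdVec_apply]⟩

/-- If every point is regular, `φ` is a product of axis maps up to a permutation. The constants
`c i` are then `1`, because both sides of each one-dimensional relation have total mass one. -/
lemma exists_axisMap_of_commonRegularSet_eq_univ {g d : E n → E m} {pg pd : Fin n → ℝ → ℝ}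
    (hg : IsGenerator g) (hd : IsGenerator d) (hpg : IsFactorPrior pg) (hpd : IsFactorPrior pd)
    (hCg : ∀ᵐ z : E n, C1At g z ∧ C2At g z) (hCd : ∀ᵐ z : E n, C1At d z ∧ C2At d z)
    (hM : range g = range d) (hmatch : pushforward g pg = pushforward d pd)
    (hH : ∀ᵐ z : E n, 0 < priorDensity pg z ∧ HasSimpleTangentHessian g pg z)
    (hW : commonRegularSet g d = univ) :
    ∃ (σ : Equiv.Perm (Fin n)) (ε : Fin n → ℝ) (h : Fin n → ℝ → ℝ),
      (∀ i, ε i = 1 ∨ ε i = -1) ∧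
      (∀ i, ContDiff ℝ 2 (h i) ∧ Function.Bijective (h i) ∧ ∀ t, 0 < ε i * deriv (h i) t) ∧
      (∀ z i, transition g d z (σ i) = h i (z i)) ∧
      (∀ z i, seamDir d i z = ε i • seamDir g (σ i) (transition g d z) ∧
        seam d (range d) i (d z) = seam g (range g) (σ i) (d z)) ∧
      (∀ i, (factorMeasure pd i).map (h i) = factorMeasure pg (σ i)) ∧
      (∀ᵐ z : E n, ∀ i,
        seamDensity d pd i z = seamDensity g pg (σ i) (transition g d z)) := by
  have hmem : ∀ z, z ∈ commonRegularSet g d := fun z => hW ▸ mem_univ z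
  obtain ⟨σ, ε, c, hε, hc0, -, hmain, hdens⟩ := exists_perm_sign_const hg hd hpg hpd hCg hCd hM
    hmatch hH (hmem 0)
  rw [hW, connectedComponentIn_univ, PreconnectedSpace.connectedComponent_eq_univ, image_univ]
    at hmain
  rw [hW, connectedComponentIn_univ, PreconnectedSpace.connectedComponent_eq_univ] at hdens
  have hφ2 : ContDiff ℝ 2 (transition g d) :=
    contDiff_iff_contDiffAt.2 fun z => contDiffAt_transition hg hd hM (hmem z)
  have hφ : Differentiable ℝ (transition g d) := hφ2.differentiable (by norm_num)
  have hder : ∀ y i, ∃ c : ℝ, fderiv ℝ (transition g d) y (stdVec i) = c • stdVec (σ i) := by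
    intro y i
    obtain ⟨-, -, a, -, ha⟩ := hmain y (mem_univ y) i
    exact ⟨_, ha⟩
  have hbij := bijective_axisMap hφ hder (isHomeomorph_transition hg hd hM).bijective
  have hεsq : ∀ i, ε i * ε i = 1 := fun i => by rcases hε i with h | h <;> simp [h]
  -- the derivative at `t` of the `i`-th axis map is read off from `Dφ` at any `z` with `z i = t`
  have hdh : ∀ z i, ∃ a : ℝ, 0 < a ∧ HasDerivAt (axisMap (transition g d) σ i) (ε i * a) (z i) ∧
      singVal d i z = a * singVal g (σ i) (transition g d z) := by
    intro z i
    obtain ⟨-, -, a, ha, hda⟩ := hmain z (mem_univ z) i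
    exact ⟨a, ha, hasDerivAt_axisMap hφ hder hda,
      singVal_eq_mul_singVal hg hd hM (hmem z) (hε i) ha hda⟩
  have hdt : ∀ i t, ∃ a : ℝ, 0 < a ∧ HasDerivAt (axisMap (transition g d) σ i) (ε i * a) t := by
    intro i t
    obtain ⟨a, ha, h, -⟩ := hdh (t • stdVec i) i
    exact ⟨a, ha, by simpa [stdVec_apply] using h⟩
  have hfac : ∀ i, c i = 1 ∧ (factorMeasure pd i).map (axisMap (transition g d) σ i) =
      factorMeasure pg (σ i) := by
    intro i
    refine map_factorMeasure_eq hpd hpg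
      (fun t => ((hdt i t).choose_spec.2.differentiableAt).hasDerivAt) (hbij i) (hc0 i)
      (ae_of_ae_apply (i := i) ?_)
    filter_upwards [hdens] with z hz
    obtain ⟨a, ha, hda, hs⟩ := hdh z i
    have h1 := hz (mem_univ z) i
    have hsg := singVal_pos (hmem z).2 (σ i)
    rw [seamDensity, seamDensity, hs, apply_eq_axisMap hφ hder] at h1
    have habs : |ε i * a| = a := by
      rw [abs_mul, abs_of_pos ha]
      rcases hε i with h | h <;> simp [h]
    rw [hda.deriv, habs]
    field_simp at h1
    linarith
  refine ⟨σ, ε, axisMap (transition g d) σ, hε, fun i => ⟨?_, hbij i, fun t => ?_⟩,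
    apply_eq_axisMap hφ hder, fun z i => ?_, fun i => (hfac i).2, ?_⟩
  · have h1 : ContDiff ℝ 2 fun t : ℝ => t • (stdVec i : E n) := contDiff_id.smul contDiff_const
    exact (EuclideanSpace.proj (σ i) : E n →L[ℝ] ℝ).contDiff.comp (hφ2.comp h1)
  · obtain ⟨a, ha, hda⟩ := hdt i t
    rw [hda.deriv, ← mul_assoc, hεsq, one_mul]
    exact ha
  · obtain ⟨h1, h2, -⟩ := hmain z (mem_univ z) i
    exact ⟨h1, by rw [h2, hM]⟩
  · filter_upwards [hdens] with z hz i
    rw [hz (mem_univ z) i, (hfac i).1, one_mul]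

end SeamBSS

theorem mainTheorem8 {n m : ℕ} (g d : SeamBSS.E n → SeamBSS.E m) (pg pd : Fin n → ℝ → ℝ)
    (hg : SeamBSS.IsGenerator g) (hd : SeamBSS.IsGenerator d)
    (hpg : SeamBSS.IsFactorPrior pg) (hpd : SeamBSS.IsFactorPrior pd)
    (hCg : ∀ᵐ z : SeamBSS.E n, SeamBSS.C1At g z ∧ SeamBSS.C2At g z)
    (hCd : ∀ᵐ z : SeamBSS.E n, SeamBSS.C1At d z ∧ SeamBSS.C2At d z)
    (hM : range g = range d)
    (hmatch : SeamBSS.pushforward g pg = SeamBSS.pushforward d pd)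
    (hH : ∀ᵐ z : SeamBSS.E n,
      0 < SeamBSS.priorDensity pg z ∧ SeamBSS.HasSimpleTangentHessian g pg z)
    (φ : SeamBSS.E n → SeamBSS.E n) (hφ : φ = SeamBSS.transition g d)
    (W : Set (SeamBSS.E n)) (hW : W = SeamBSS.commonRegularSet g d) :
    -- `g` and its prior are recovered from `d` and its prior through `φ`
    (IsHomeomorph φ ∧ g ∘ φ = d ∧
      (SeamBSS.priorMeasure pd).map φ = SeamBSS.priorMeasure pg) ∧
    -- `φ` is a diffeomorphism between the regular sets, which carry the whole distribution
    (SeamBSS.IsDiffeoOn φ W ∧ ∀ᵐ z ∂(SeamBSS.priorMeasure pd), z ∈ W) ∧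
    -- both families of seam densities factorise the common manifold density
    (∀ᵐ z ∂(volume.restrict W),
      SeamBSS.manifoldDensity g pg (d z) = SeamBSS.manifoldDensity d pd (d z) ∧
      SeamBSS.manifoldDensity d pd (d z) = ∏ i, SeamBSS.seamDensity d pd i z ∧
      SeamBSS.manifoldDensity g pg (d z) = ∏ i, SeamBSS.seamDensity g pg i (φ z)) ∧
    -- on each connected component the two seam decompositions agree up to permutation and sign
    (∀ z₀ ∈ W, ∃ (σ : Equiv.Perm (Fin n)) (ε : Fin n → ℝ) (c : Fin n → ℝ),
      (∀ i, ε i = 1 ∨ ε i = -1) ∧ (∀ i, 0 < c i) ∧ ∏ i, c i = 1 ∧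
      (∀ z ∈ connectedComponentIn W z₀, ∀ i,
        SeamBSS.seamDir d i z = ε i • SeamBSS.seamDir g (σ i) (φ z) ∧
        SeamBSS.seam d (d '' W) i (d z) = SeamBSS.seam g (d '' W) (σ i) (d z) ∧
        ∃ a : ℝ, 0 < a ∧ fderiv ℝ φ z (SeamBSS.stdVec i) = (ε i * a) • SeamBSS.stdVec (σ i)) ∧
      (∀ᵐ z ∂(volume.restrict (connectedComponentIn W z₀)), ∀ i,
        SeamBSS.seamDensity d pd i z = c i * SeamBSS.seamDensity g pg (σ i) (φ z))) ∧
    -- if every point is regular, `φ` is globally an axis-aligned diffeomorphism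
    (W = univ → ∃ (σ : Equiv.Perm (Fin n)) (ε : Fin n → ℝ) (h : Fin n → ℝ → ℝ),
      (∀ i, ε i = 1 ∨ ε i = -1) ∧
      (∀ i, ContDiff ℝ 2 (h i) ∧ Function.Bijective (h i) ∧ ∀ t, 0 < ε i * deriv (h i) t) ∧
      (∀ z i, φ z (σ i) = h i (z i)) ∧
      (∀ z i, SeamBSS.seamDir d i z = ε i • SeamBSS.seamDir g (σ i) (φ z) ∧
        SeamBSS.seam d (range d) i (d z) = SeamBSS.seam g (range g) (σ i) (d z)) ∧
      (∀ i, (SeamBSS.factorMeasure pd i).map (h i) = SeamBSS.factorMeasure pg (σ i)) ∧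
      (∀ᵐ z : SeamBSS.E n, ∀ i,
        SeamBSS.seamDensity d pd i z = SeamBSS.seamDensity g pg (σ i) (φ z))) := by
  subst hφ hW
  have hWm := (SeamBSS.isOpen_commonRegularSet hg hd hM).measurableSet
  refine ⟨⟨SeamBSS.isHomeomorph_transition hg hd hM, funext (SeamBSS.apply_transition hM),
      SeamBSS.map_transition_priorMeasure hg hd hM hmatch⟩,
    ⟨SeamBSS.isDiffeoOn_transition hg hd hM,
      SeamBSS.ae_mem_commonRegularSet hg hd hM hmatch⟩, ?_, fun z₀ hz₀ => ?_,
    SeamBSS.exists_axisMap_of_commonRegularSet_eq_univ hg hd hpg hpd hCg hCd hM hmatch hH⟩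
  · rw [ae_restrict_iff' hWm]
    filter_upwards [SeamBSS.ae_manifoldDensity_eq hg hd hpg hpd hM hmatch] with z hz hzW
    refine ⟨hz hzW, SeamBSS.manifoldDensity_eq_prod_seamDensity hd.isEmbedding.injective hCd pd
      hzW.1, ?_⟩
    rw [← SeamBSS.apply_transition hM z]
    exact SeamBSS.manifoldDensity_eq_prod_seamDensity hg.isEmbedding.injective hCg pg hzW.2
  · obtain ⟨σ, ε, c, h1, h2, h3, h4, h5⟩ :=
      SeamBSS.exists_perm_sign_const hg hd hpg hpd hCg hCd hM hmatch hH hz₀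
    exact ⟨σ, ε, c, h1, h2, h3, h4, (ae_restrict_iff' (SeamBSS.isOpen_commonRegularSet
      hg hd hM).connectedComponentIn.measurableSet).2 h5⟩
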